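/- Let $\mathcal G$ be the dumbbell graph: two vertices joined by an edge $e_3$, with a loop $e_1$ at the first vertex and a loop $e_2$ at the second. Each edge $e$ gives two directed edges $e,\bar e$; let $A(e,e')=1$ if the directed edge $e'$ starts where $e$ ends and $e'\neq\bar e$, and $A(e,e')=0$ otherwise. Let $\Sigma_A^+$ be the one-sided subshift of finite type of $A$, with shift $\sigma$. For $l:\{e_1,e_2,e_3\}\to\mathbb R_{>0}$ the entropy is $$h(l)=\lim_{T\to\infty}\frac1T\log\#\{\gamma:\ l(\gamma)<T\},$$ where $\gamma$ runs over the closed cycles $(e_0,e_1,\dots,e_n=e_0)$ of directed edges without backtracking and $l(\gamma)=\sum_{i<n}l(e_i)$; let $\mathcal M^1=\{l>0:\ h(l)=1\}$. A function $\phi$ of edges is regarded as the function $\phi(\underline e)=\phi(e_0)$ on $\Sigma_A^+$. For continuous $f$ on $\Sigma_A^+$ let $\mathcal L_f w(\underline x)=\sum_{\sigma\underline y=\underline x}e^{f(\underline y)}w(\underline y)$, let $\beta_f$ be the spectral radius of $\mathcal L_f$ on $C(\Sigma_A^+)$, and let $P(f)=\log\beta_f$. If $P(f)=0$, the equilibrium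 state of $f$ is $m_f=v_f\mu_f/\int v_f\,d\mu_f$, where $v_f>0$ is continuous with $\mathcal L_fv_f=\beta_fv_f$ and $\mu_f$ is a probability measure with $\mathcal L_f^*\mu_f=\beta_f\mu_f$. For a $\sigma$-invariant probability measure $m$ let $$\mathrm{Var}(w,m)=\lim_{n\to\infty}\frac1n\int\Big(\sum_{i=0}^{n-1}w\circ\sigma^i-n\int w\,dm\Big)^2dm .$$ The pressure metric on $T_l\mathcal M^1=\{\phi:\ \phi(\underline e)=\phi(e_0),\ \int\phi\,dm_{-l}=0\}$ is $\|\phi\|_P^2=\mathrm{Var}(\phi,m_{-l})$. **Proposition.** With $x=l(e_1)$, $y=l(e_2)$, the space $\mathcal M^1$ is the surface $$l(x,y)=(x,y,S(x,y)),\qquad S(x,y)=\log 2-\tfrac12\log\big((e^x-1)(e^y-1)\big),\qquad x,y>0,\ (e^x-1)(e^y-1)<4 .$$ At each of its points $-l$ has a unique equilibrium state $m_{-l}$, the vectors $\partial l/\partial x,\partial l/\partial y$ lie in $T_l\mathcal M^1$, and, with $\mathbf p_3=m_{-l}\{\underline e:\ e_0=e_3\}$, the first fundamental form of $(\mathcal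 M^1,\|\cdot\|_P)$ is $$E_P=\mathrm{Var}\Big(\frac{\partial l}{\partial x},m_{-l}\Big)=2\,\frac{\partial^2S}{\partial x^2}\,\mathbf p_3=\frac{e^x(e^y-1)}{(e^x-1)(4e^{x+y}-3e^x-3e^y+2)},$$ $$F_P=\frac12\Big(\mathrm{Var}\Big(\frac{\partial l}{\partial x}+\frac{\partial l}{\partial y},m_{-l}\Big)-\mathrm{Var}\Big(\frac{\partial l}{\partial x},m_{-l}\Big)-\mathrm{Var}\Big(\frac{\partial l}{\partial y},m_{-l}\Big)\Big)=0,$$ $$G_P=\mathrm{Var}\Big(\frac{\partial l}{\partial y},m_{-l}\Big)=2\,\frac{\partial^2S}{\partial y^2}\,\mathbf p_3=\frac{(e^x-1)e^y}{(e^y-1)(4e^{x+y}-3e^x-3e^y+2)},$$ that is, $\big\|a\,\frac{\partial l}{\partial x}+b\,\frac{\partial l}{\partial y}\big\|_P^2=E_Pa^2+2F_Pab+G_Pb^2$ for all $a,b\in\mathbb R$; in particular all these limits exist. -/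

import Mathlib

open Filter Topology MeasureTheory

noncomputable section

section SymbolicDynamics

variable {ι : Type*}

/-- The one-sided subshift of finite type `Σ_A⁺` of a `0`-`1` matrix `A`. It carries the subspace
topology of the product topology, and the subspace `σ`-algebra of the product `σ`-algebra. -/
abbrev Subshift (A : Matrix ι ι ℕ) : Type _ :=
  {x : ℕ → ι // ∀ n, A (x n) (x (n + 1)) = 1}

/-- The shift map `(σ x)ₙ = xₙ₊₁`. -/
def Subshift.shift {A : Matrix ι ι ℕ} (x : Subshift A) : Subshift A :=
  ⟨fun n => x.1 (n + 1), fun n => x.2 (n + 1)⟩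

/-- The sequence `i x₀ x₁ x₂ …`. The preimages of `x` under the shift are exactly the sequences
`i x₀ x₁ …` with `A i x₀ = 1`. -/
def Subshift.cons {A : Matrix ι ι ℕ} (i : ι) (x : Subshift A) (h : A i (x.1 0) = 1) :
    Subshift A :=
  ⟨fun n => Nat.casesOn n i x.1, fun n => by cases n with
    | zero => exact h
    | succ k => exact x.2 k⟩

/-- The preimages of a point under the shift, as used in the transfer operator. -/
theorem Subshift.shift_eq_iff {A : Matrix ι ι ℕ} (x y : Subshift A) :
    y.shift = x ↔ ∃ (i : ι) (h : A i (x.1 0) = 1), y = Subshift.cons i x h := by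
  constructor
  · rintro rfl
    refine ⟨y.1 0, y.2 0, Subtype.ext (funext fun n => ?_)⟩
    cases n <;> rfl
  · rintro ⟨i, h, rfl⟩
    rfl

variable [TopologicalSpace ι] [DiscreteTopology ι]

instance Subshift.compactSpace [Finite ι] (A : Matrix ι ι ℕ) : CompactSpace (Subshift A) := by
  have hc : IsClosed {x : ℕ → ι | ∀ n, A (x n) (x (n + 1)) = 1} := by
    rw [Set.ofPred_forall]
    refine isClosed_iInter fun n => ?_
    have hcont : Continuous fun x : ℕ → ι => (x n, x (n + 1)) := by fun_prop
    exact (isClosed_discrete {p : ι × ι | A p.1 p.2 = 1}).preimage hcont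
  exact isCompact_iff_compactSpace.mp hc.isCompact

/-- One summand of the transfer operator is continuous. -/
theorem Subshift.continuous_summand (A : Matrix ι ι ℕ) (i : ι) (g : C(Subshift A, ℝ)) :
    Continuous fun x : Subshift A =>
      if h : A i (x.1 0) = 1 then g (Subshift.cons i x h) else 0 := by
  classical
  rw [continuous_iff_continuousAt]
  intro x
  have hx0 : Continuous fun y : Subshift A => y.1 0 :=
    (continuous_apply (A := fun _ : ℕ => ι) 0).comp continuous_subtype_val
  have hev : ∀ᶠ y : Subshift A in 𝓝 x, y.1 0 = x.1 0 :=
    hx0.continuousAt.eventually (p := fun j => j = x.1 0) (by simp [nhds_discrete])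
  by_cases h : A i (x.1 0) = 1
  · let U : Set (Subshift A) := {y | y.1 0 = x.1 0}
    have hU : IsOpen U := (isOpen_discrete {x.1 0}).preimage hx0
    have hcont : ContinuousOn (fun x : Subshift A =>
        if h : A i (x.1 0) = 1 then g (Subshift.cons i x h) else 0) U := by
      rw [continuousOn_iff_continuous_domRestrict]
      have hA : ∀ y : U, A i (y.1.1 0) = 1 := fun y => by
        have : y.1.1 0 = x.1 0 := y.2
        rw [this]; exact h
      have hc : Continuous fun y : U => Subshift.cons i y.1 (hA y) := by
        refine Continuous.subtype_mk (continuous_pi fun n => ?_) _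
        cases n with
        | zero => exact continuous_const
        | succ k => exact (continuous_apply k).comp (continuous_subtype_val.comp
            continuous_subtype_val)
      convert g.continuous.comp hc using 1
      funext y
      simp [hA y]
    exact hcont.continuousAt (hU.mem_nhds rfl)
  · refine ContinuousAt.congr (f := fun _ => (0 : ℝ)) continuousAt_const ?_
    filter_upwards [hev] with y hy
    rw [dif_neg]
    rw [hy]; exact h

variable [Fintype ι] {A : Matrix ι ι ℕ}

/-- The transfer operator of `f` applied to `w`:
`(𝓛_f w)(x) = ∑_{σ y = x} exp (f y) * w y`, a continuous function of `x`. -/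
def transferFun (f w : C(Subshift A, ℝ)) : C(Subshift A, ℝ) where
  toFun x := ∑ i : ι, if h : A i (x.1 0) = 1 then
    Real.exp (f (Subshift.cons i x h)) * w (Subshift.cons i x h) else 0
  continuous_toFun := continuous_finsetSum _ fun i _ =>
    Subshift.continuous_summand A i ⟨fun y => Real.exp (f y) * w y, by fun_prop⟩

theorem abs_transferFun_le (f w : C(Subshift A, ℝ)) :
    ‖transferFun f w‖ ≤ (Fintype.card ι * Real.exp ‖f‖) * ‖w‖ := by
  rw [ContinuousMap.norm_le _ (by positivity)]
  intro x
  have hsum : ∀ i ∈ (Finset.univ : Finset ι),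
      ‖(if h : A i (x.1 0) = 1 then
        Real.exp (f (Subshift.cons i x h)) * w (Subshift.cons i x h) else 0 : ℝ)‖
        ≤ Real.exp ‖f‖ * ‖w‖ := by
    intro i _
    split_ifs with h
    · rw [norm_mul, Real.norm_eq_abs, Real.abs_exp]
      gcongr
      · exact (le_abs_self _).trans (f.norm_coe_le_norm _)
      · exact w.norm_coe_le_norm _
    · rw [norm_zero]; positivity
  calc ‖transferFun f w x‖ ≤ ∑ _i : ι, Real.exp ‖f‖ * ‖w‖ := norm_sum_le_of_le _ hsum
    _ = _ := by simp [mul_assoc]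

/-- The transfer (Ruelle) operator `𝓛_f` as a bounded operator on `C(Σ_A⁺)`. -/
def transferOp (f : C(Subshift A, ℝ)) : C(Subshift A, ℝ) →L[ℝ] C(Subshift A, ℝ) :=
  LinearMap.mkContinuous
    { toFun := transferFun f
      map_add' := fun u w => by
        ext x
        simp only [transferFun, ContinuousMap.coe_mk, ContinuousMap.add_apply,
          ← Finset.sum_add_distrib]
        refine Finset.sum_congr rfl fun i _ => ?_
        split_ifs <;> ring
      map_smul' := fun c w => by
        ext x
        simp only [transferFun, ContinuousMap.coe_mk, ContinuousMap.smul_apply, smul_eq_mul,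
          RingHom.id_apply, Finset.mul_sum]
        refine Finset.sum_congr rfl fun i _ => ?_
        split_ifs <;> ring }
    (Fintype.card ι * Real.exp ‖f‖) (abs_transferFun_le f)

/-- The spectral radius `β_f` of the transfer operator `𝓛_f` on `C(Σ_A⁺)`. -/
def perronValue (f : C(Subshift A, ℝ)) : ℝ := (spectralRadius ℝ (transferOp f)).toReal

/-- The pressure `P(f) = log β_f`. -/
def pressure (f : C(Subshift A, ℝ)) : ℝ := Real.log (perronValue f)

/-- `m` is the equilibrium state `m_f = v_f μ_f / ∫ v_f dμ_f` of a function `f` of pressure zero,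
where `v_f` is a strictly positive eigenfunction of `𝓛_f` and `μ_f` a probability measure that is
an eigenmeasure of the dual of `𝓛_f`, both for the eigenvalue `β_f`. -/
def IsEquilibriumState [MeasurableSpace ι] [DiscreteMeasurableSpace ι] (f : C(Subshift A, ℝ)) (m : Measure (Subshift A)) :
    Prop :=
  pressure f = 0 ∧
  ∃ (v : C(Subshift A, ℝ)) (μ : Measure (Subshift A)),
    (∀ x, 0 < v x) ∧ transferOp f v = perronValue f • v ∧
    IsProbabilityMeasure μ ∧
    (∀ φ : C(Subshift A, ℝ), ∫ x, transferOp f φ x ∂μ = perronValue f * ∫ x, φ x ∂μ) ∧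
    m = μ.withDensity fun x => ENNReal.ofReal (v x / ∫ y, v y ∂μ)

/-- `Var(w, μ) = s`: the limit `lim (1/n) ∫ (wⁿ - n ∫ w dμ)² dμ`, with
`wⁿ = ∑_{i<n} w ∘ σⁱ`, exists and equals `s`. -/
def HasVariance [MeasurableSpace ι] [DiscreteMeasurableSpace ι] (w : C(Subshift A, ℝ)) (μ : Measure (Subshift A)) (s : ℝ) :
    Prop :=
  Tendsto (fun n : ℕ => (1 / (n : ℝ)) *
    ∫ x, (birkhoffSum Subshift.shift w n x - n * ∫ y, w y ∂μ) ^ 2 ∂μ) atTop (𝓝 s)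

end SymbolicDynamics

section MetricGraphs

/-- An undirected graph with vertices `V` and edges `E`; loops and multiple edges are allowed.
The endpoints of each edge are listed in an arbitrary reference order. -/
structure UGraph (V E : Type*) where
  ini : E → V
  ter : E → V

namespace UGraph

variable {V E : Type*} (G : UGraph V E)

/-- Initial vertex of a directed edge. The directed edges are the pairs `(e, b)`: the edge `e`
travelled from `ini e` to `ter e` if `b = true`, and the other way if `b = false`. -/
def start (d : E × Bool) : V := if d.2 then G.ini d.1 else G.ter d.1

/-- Terminal vertex of a directed edge. -/
def finish (d : E × Bool) : V := if d.2 then G.ter d.1 else G.ini d.1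

/-- The directed edge with the opposite direction. -/
def rev (d : E × Bool) : E × Bool := (d.1, !d.2)

/-- The adjacency matrix on directed edges: `A(e, e') = 1` if `e'` follows `e` and `e' ≠ ē`. -/
def adj [DecidableEq V] [DecidableEq E] : Matrix (E × Bool) (E × Bool) ℕ := fun d d' =>
  if G.finish d = G.start d' ∧ d' ≠ rev d then 1 else 0

variable [DecidableEq V] [DecidableEq E]

/-- The closed cycles `(e₀, …, eₙ, e₀)` of directed edges without backtracking and of total length
`< T` (the addition in `Fin (n + 1)` is cyclic, so the last edge is followed by the first). -/
def closedCycles (l : E → ℝ) (T : ℝ) : Set (Σ n : ℕ, Fin (n + 1) → E × Bool) :=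
  {γ | (∀ i, G.adj (γ.2 i) (γ.2 (i + 1)) = 1) ∧ ∑ i, l (γ.2 i).1 < T}

/-- The entropy `lim_{T → ∞} (1/T) log #{γ ; l(γ) < T}` of `(G, l)` exists and equals `h`. -/
def HasEntropy (l : E → ℝ) (h : ℝ) : Prop :=
  Tendsto (fun T : ℝ => (1 / T) * Real.log ((G.closedCycles l T).ncard : ℝ)) atTop (𝓝 h)

/-- The moduli space `𝓜¹_G` of positive edge weightings of entropy `1`. -/
def moduliSpace : Set (E → ℝ) := {l | (∀ e, 0 < l e) ∧ G.HasEntropy l 1}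

variable [TopologicalSpace E] [DiscreteTopology E]

/-- A function of edges, as the function `e₀e₁e₂… ↦ φ(e₀)` on the space of paths. -/
def edgeFun (φ : E → ℝ) : C(Subshift G.adj, ℝ) where
  toFun x := φ (x.1 0).1
  continuous_toFun := (continuous_of_discreteTopology (f := fun d : E × Bool => φ d.1)).comp
    ((continuous_apply (A := fun _ : ℕ => E × Bool) 0).comp continuous_subtype_val)

/-- The tangent space of `𝓜¹_G` at a weighting `l`, where `m` is the equilibrium state of `-l`:
the functions of the zeroth directed edge with zero integral. -/
def tangentSpace [MeasurableSpace E] [DiscreteMeasurableSpace E] (m : Measure (Subshift G.adj)) :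
    Set C(Subshift G.adj, ℝ) :=
  {φ | (∃ ψ : E × Bool → ℝ, ∀ x, φ x = ψ (x.1 0)) ∧ ∫ x, φ x ∂m = 0}

end UGraph

end MetricGraphs

section Dumbbell

/-- The dumbbell: two vertices, a loop `0` at the first one, a loop `1` at the second one, and
an edge `2` that joins the two vertices. -/
def dumbbell : UGraph (Fin 2) (Fin 3) where
  ini := ![0, 1, 0]
  ter := ![0, 1, 1]

/-- The length of the joining edge on the surface of entropy `1`, as a function of the lengths
`x`, `y` of the two loops. -/
def dumbbellS (x y : ℝ) : ℝ :=
  Real.log 2 - 1 / 2 * Real.log ((Real.exp x - 1) * (Real.exp y - 1))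

/-- The parametrization `l(x, y) = (x, y, S(x, y))`. -/
def dumbbellLength (x y : ℝ) : Fin 3 → ℝ := ![x, y, dumbbellS x y]

/-- The domain of the parametrization: `x`, `y` and `S(x, y)` are positive. -/
def dumbbellDomain : Set (ℝ × ℝ) :=
  {q | 0 < q.1 ∧ 0 < q.2 ∧ (Real.exp q.1 - 1) * (Real.exp q.2 - 1) < 4}

/-- The coordinate vector field `∂l/∂x`. -/
def dumbbellDx (x y : ℝ) : Fin 3 → ℝ := deriv (fun s => dumbbellLength s y) x

/-- The coordinate vector field `∂l/∂y`. -/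
def dumbbellDy (x y : ℝ) : Fin 3 → ℝ := deriv (fun s => dumbbellLength x s) y

end Dumbbell

end

/-! Write `a² = e^x - 1`, `b² = e^y - 1`. On the surface `e^S = 2/(ab)`, and the matrix of `exp
(-l)` on admissible pairs of directed edges is irreducible with explicit positive right and left
eigenvectors `dumbbellRight`, `dumbbellLeft` for the eigenvalue `1`.

Entropy. The right eigenvector squeezes the number of paths of length `< T` between multiples of
`e^T`, so the entropy is `1` on the surface (`hasEntropy_one`). Conversely every `l > 0` has a
multiple `s • l` on the surface, hence entropy `s` by scaling, and entropy `1` forces `s = 1`.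

Equilibrium state. The left eigenvector is a positive fixed function of the transfer operator, which
is therefore power bounded with spectral radius `1`. A maximum principle makes the eigenfunction
unique up to a factor; Cesàro means give an eigenmeasure; its values on letters are the normalized
right eigenvector, and these determine it, since the operator removes one letter at a time.

Variance. Under `m` the edges form a Markov chain. Between consecutive crossings of the bridge in a
fixed direction, the numbers of turns on the two loops are independent geometric variables with
variances `e^x/(e^x-1)² = 2 S_xx` and `e^y/(e^y-1)² = 2 S_yy`. Such cycles have frequency `p₃`, and
a tangent vector sums over a cycle to a combination of the two centred counts. This explains the
factors `2 S_xx p₃`, `2 S_yy p₃` and the vanishing of `F_P`. The proof replaces renewal theory by a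
martingale decomposition: it writes the tangent vector as `ζ - ζ'`, where `ζ'` is the conditional
expectation of `ζ` given the shift, and then the variance is `∫ (ζ² - ζ'²) dm`
(`hasVariance_letterFun`, `dumbbell_hasVariance`). -/

noncomputable section

/-! ### Exponential bounds for the number of paths. -/

section PathCounting

variable {D : Type*}

/-- The finite paths for the relation `R` that start with `d`, whose last term is followed by `b`,
and whose total `l`-length is less than `T`. -/
def pathsTo (R : D → D → Prop) (l : D → ℝ) (b d : D) (T : ℝ) : Set (Σ n : ℕ, Fin (n + 1) → D) :=
  {γ | γ.2 0 = d ∧ (∀ i : Fin γ.1, R (γ.2 i.castSucc) (γ.2 i.succ)) ∧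
    R (γ.2 (Fin.last _)) b ∧ ∑ i, l (γ.2 i) < T}

/-- Prepend a term to a nonempty finite sequence. -/
def consPath (d : D) (γ : Σ n : ℕ, Fin (n + 1) → D) : Σ n : ℕ, Fin (n + 1) → D :=
  ⟨γ.1 + 1, Fin.cons d γ.2⟩

theorem consPath_injective (d : D) : Function.Injective (consPath d) := by
  rintro ⟨n, γ⟩ ⟨m, δ⟩ h
  simp only [consPath, Sigma.mk.injEq, Nat.add_right_cancel_iff] at h
  obtain ⟨rfl, h⟩ := h
  have := Fin.cons_right_injective (α := fun _ => D) d (eq_of_heq h)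
  rw [this]

theorem consPath_mem_pathsTo {R : D → D → Prop} {l : D → ℝ} {b d d' : D} {T : ℝ}
    {γ : Σ n : ℕ, Fin (n + 1) → D} (hR : R d d') (h : γ ∈ pathsTo R l b d' (T - l d)) :
    consPath d γ ∈ pathsTo R l b d T := by
  obtain ⟨n, γ⟩ := γ
  obtain ⟨h0, h1, h2, h3⟩ := h
  refine ⟨rfl, ?_, ?_, ?_⟩
  · intro i
    refine Fin.cases ?_ (fun j => ?_) i
    · simp only [consPath]
      rw [← h0] at hR
      exact hR
    · have := h1 j
      simpa [consPath] using this
  · simpa [consPath, ← Fin.succ_last] using h2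
  · have : ∑ i, l ((consPath d ⟨n, γ⟩).2 i) = l d + ∑ i, l (γ i) := by
      exact Fin.sum_univ_succ fun i => l ((Fin.cons d γ : Fin (n + 1 + 1) → D) i)
    rw [this]
    simp only at h3
    linarith

/-- Splitting off the first term gives the renewal recursion on which the upper count rests;
`consPath_mem_pathsTo` is its converse, for the lower count. -/
theorem pathsTo_cases {R : D → D → Prop} {l : D → ℝ} {b d : D} {T : ℝ}
    {γ : Σ n : ℕ, Fin (n + 1) → D} (h : γ ∈ pathsTo R l b d T) :
    γ = ⟨0, fun _ => d⟩ ∨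
      ∃ d' δ, R d d' ∧ δ ∈ pathsTo R l b d' (T - l d) ∧ γ = consPath d δ := by
  obtain ⟨n, γ⟩ := γ
  obtain ⟨h0, h1, h2, h3⟩ := h
  simp only at h0 h1 h2 h3
  cases n with
  | zero =>
    left
    congr 1
    funext i
    rw [Subsingleton.elim (α := Fin 1) i 0]
    exact h0
  | succ n =>
    right
    refine ⟨γ 1, ⟨n, Fin.tail γ⟩, ?_, ⟨rfl, ?_, ?_, ?_⟩, ?_⟩
    · have := h1 0
      simpa [h0] using this
    · intro i
      have := h1 i.succ
      simpa [Fin.tail] using this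
    · simpa [Fin.tail] using h2
    · rw [Fin.sum_univ_succ, h0] at h3
      simp only [Fin.tail]
      linarith
    · simp only [consPath]
      rw [← h0, Fin.cons_self_tail]

theorem pathsTo_eq_empty {R : D → D → Prop} {l : D → ℝ} (hl : ∀ d, 0 < l d) {b d : D} {T : ℝ}
    (hT : T ≤ 0) : pathsTo R l b d T = ∅ := by
  ext γ
  simp only [Set.mem_empty_iff_false, iff_false]
  rintro ⟨-, -, -, h⟩
  have : 0 ≤ ∑ i, l (γ.2 i) := Finset.sum_nonneg fun i _ => (hl _).le
  linarith

theorem pathsTo_mono {R : D → D → Prop} {l : D → ℝ} {b d : D} {T T' : ℝ} (h : T ≤ T') :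
    pathsTo R l b d T ⊆ pathsTo R l b d T' :=
  fun _ hγ => ⟨hγ.1, hγ.2.1, hγ.2.2.1, hγ.2.2.2.trans_le h⟩

theorem exists_pathsTo_nonempty {R : D → D → Prop} (l : D → ℝ) {b d : D}
    (h : Relation.TransGen R d b) : ∃ T, (pathsTo R l b d T).Nonempty := by
  induction h using Relation.TransGen.head_induction_on with
  | single h =>
    rename_i a
    exact ⟨l a + 1, ⟨0, fun _ => a⟩, rfl, fun i => i.elim0, h, by simp⟩
  | head h _ ih =>
    rename_i a c _
    obtain ⟨T, γ, hγ⟩ := ih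
    exact ⟨T + l a, consPath a γ, consPath_mem_pathsTo h (by rwa [add_sub_cancel_right])⟩

variable [Fintype D]

open scoped Classical in
/-- An upper bound for the number of paths of length less than `T`, from a positive solution of
the eigenvector equation. -/
theorem exists_pathsTo_subset_card_le {R : D → D → Prop} {l v : D → ℝ} (hl : ∀ d, 0 < l d)
    (hv : ∀ d, 0 < v d) (hlv : ∀ d, Real.exp (l d) * v d = ∑ d', if R d d' then v d' else 0) :
    ∃ C : ℝ, 0 < C ∧ ∀ b d T, ∃ s : Finset (Σ n : ℕ, Fin (n + 1) → D),
      pathsTo R l b d T ⊆ s ∧ (s.card : ℝ) ≤ C * Real.exp T := by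
  rcases isEmpty_or_nonempty D with hD | hD
  · exact ⟨1, one_pos, fun b => hD.elim b⟩
  obtain ⟨dm, hdm⟩ := Finite.exists_min l
  obtain ⟨dM, hdM⟩ := Finite.exists_max l
  obtain ⟨dw, hdw⟩ := Finite.exists_max v
  obtain ⟨dc, hdc⟩ := Finite.exists_max fun d => 1 / ((Real.exp (l d) - 1) * v d)
  have hpos : ∀ d, 0 < (Real.exp (l d) - 1) * v d := fun d =>
    mul_pos (by have := Real.add_one_lt_exp (hl d).ne'; have := hl d; linarith) (hv d)
  -- The largest of these quotients, so that `C₂ (e^{l d} - 1) v d ≥ 1` for all `d`. The correction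
  -- `-C₂` in the bound below then absorbs the `1` that the one-term path adds at each step of the
  -- recursion.
  set C₂ := 1 / ((Real.exp (l dc) - 1) * v dc) with hC₂
  have hC₂0 : 0 < C₂ := one_div_pos.2 (hpos dc)
  have hC₂d : ∀ d, 1 ≤ C₂ * ((Real.exp (l d) - 1) * v d) := fun d => by
    have := hdc d
    rwa [div_le_iff₀ (hpos d)] at this
  -- Keeps the bound nonnegative down to `T = -max l`, the lowest value that one step back from a
  -- positive `T` can reach.
  set C₁ := C₂ * Real.exp (l dM) with hC₁
  have hC₁0 : 0 < C₁ := by positivity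
  have key : ∀ n : ℕ, ∀ b d T, -l dM ≤ T → T ≤ n * l dm →
      ∃ s : Finset (Σ n : ℕ, Fin (n + 1) → D),
        pathsTo R l b d T ⊆ s ∧ (s.card : ℝ) ≤ v d * (C₁ * Real.exp T - C₂) := by
    have base : ∀ b d T, -l dM ≤ T → T ≤ 0 → ∃ s : Finset (Σ n : ℕ, Fin (n + 1) → D),
        pathsTo R l b d T ⊆ s ∧ (s.card : ℝ) ≤ v d * (C₁ * Real.exp T - C₂) := by
      intro b d T h1 h2
      refine ⟨∅, by simp [pathsTo_eq_empty hl h2], ?_⟩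
      simp only [Finset.card_empty, Nat.cast_zero]
      refine mul_nonneg (hv d).le ?_
      have : 1 ≤ Real.exp (l dM) * Real.exp T := by
        rw [← Real.exp_add]; exact Real.one_le_exp (by linarith)
      rw [hC₁]
      nlinarith
    intro n
    induction n with
    | zero => intro b d T h1 h2; exact base b d T h1 (by simpa using h2)
    | succ n ih =>
      intro b d T h1 h2
      rcases le_or_gt T 0 with hT | hT
      · exact base b d T h1 hT
      · have h3 : ∀ d', ∃ s : Finset (Σ n : ℕ, Fin (n + 1) → D),
            pathsTo R l b d' (T - l d) ⊆ s ∧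
            (s.card : ℝ) ≤ v d' * (C₁ * Real.exp (T - l d) - C₂) := fun d' => by
          refine ih b d' _ ?_ ?_
          · have := hdM d; linarith
          · have := hdm d; push_cast at h2; linarith
        choose s hs1 hs2 using h3
        refine ⟨insert ⟨0, fun _ => d⟩ ((Finset.univ.filter (R d)).biUnion
          fun d' => (s d').image (consPath d)), ?_, ?_⟩
        · intro γ hγ
          rcases pathsTo_cases hγ with rfl | ⟨d', δ, hd', hδ, rfl⟩
          · simp
          · simp only [Finset.coe_insert, Set.mem_insert_iff, Finset.mem_coe, Finset.mem_biUnion,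
              Finset.mem_filter, Finset.mem_univ, true_and, Finset.mem_image]
            exact Or.inr ⟨d', hd', δ, hs1 d' hδ, rfl⟩
        · have c1 := Finset.card_insert_le (⟨0, fun _ => d⟩ : Σ n : ℕ, Fin (n + 1) → D)
            ((Finset.univ.filter (R d)).biUnion fun d' => (s d').image (consPath d))
          have c2 : ((Finset.univ.filter (R d)).biUnion fun d' => (s d').image (consPath d)).card
              ≤ ∑ d' ∈ Finset.univ.filter (R d), (s d').card :=
            Finset.card_biUnion_le.trans (Finset.sum_le_sum fun d' _ => Finset.card_image_le)
          have c3 : (∑ d' ∈ Finset.univ.filter (R d), ((s d').card : ℝ)) ≤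
              (Real.exp (l d) * v d) * (C₁ * Real.exp (T - l d) - C₂) := by
            rw [hlv, ← Finset.sum_filter, Finset.sum_mul]
            exact Finset.sum_le_sum fun d' _ => hs2 d'
          have c4 : Real.exp (l d) * Real.exp (T - l d) = Real.exp T := by
            rw [← Real.exp_add]; congr 1; ring
          have c5 : ((insert (⟨0, fun _ => d⟩ : Σ n : ℕ, Fin (n + 1) → D)
              ((Finset.univ.filter (R d)).biUnion fun d' => (s d').image (consPath d))).card : ℝ)
              ≤ ∑ d' ∈ Finset.univ.filter (R d), ((s d').card : ℝ) + 1 := by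
            exact_mod_cast c1.trans (Nat.add_le_add_right c2 1)
          have := hC₂d d
          calc _ ≤ _ := c5
            _ ≤ (Real.exp (l d) * v d) * (C₁ * Real.exp (T - l d) - C₂) + 1 := by linarith
            _ = v d * C₁ * (Real.exp (l d) * Real.exp (T - l d))
                - Real.exp (l d) * v d * C₂ + 1 := by ring
            _ ≤ _ := by rw [c4]; linarith
  refine ⟨v dw * C₁, mul_pos (hv _) hC₁0, fun b d T => ?_⟩
  rcases le_or_gt T (-l dM) with hT | hT
  · refine ⟨∅, by simp [pathsTo_eq_empty hl (hT.trans (neg_nonpos.2 (hl _).le))], ?_⟩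
    have := hv dw
    simp only [Finset.card_empty, Nat.cast_zero]
    positivity
  · obtain ⟨n, hn⟩ := exists_nat_ge (T / l dm)
    obtain ⟨s, h1, h2⟩ := key n b d T hT.le (by rwa [div_le_iff₀ (hl dm)] at hn)
    refine ⟨s, h1, h2.trans ?_⟩
    calc v d * (C₁ * Real.exp T - C₂) ≤ v d * (C₁ * Real.exp T) :=
          mul_le_mul_of_nonneg_left (by linarith) (hv d).le
      _ ≤ v dw * (C₁ * Real.exp T) :=
          mul_le_mul_of_nonneg_right (hdw d) (by positivity)
      _ = _ := by ring

open scoped Classical in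
/-- A lower bound for the number of paths of length less than `T`, from a positive solution of
the eigenvector equation. -/
theorem exists_subset_pathsTo_le_card {R : D → D → Prop} {l v : D → ℝ} (hl : ∀ d, 0 < l d)
    (hv : ∀ d, 0 < v d) (hlv : ∀ d, Real.exp (l d) * v d = ∑ d', if R d d' then v d' else 0)
    (hR : ∀ d d', Relation.TransGen R d d') (b : D) :
    ∃ c T₀ : ℝ, 0 < c ∧ ∀ T, T₀ < T → ∃ s : Finset (Σ n : ℕ, Fin (n + 1) → D),
      ↑s ⊆ pathsTo R l b b T ∧ c * Real.exp T ≤ s.card := by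
  have : Nonempty D := ⟨b⟩
  obtain ⟨dm, hdm⟩ := Finite.exists_min l
  obtain ⟨dM, hdM⟩ := Finite.exists_max l
  obtain ⟨dw, hdw⟩ := Finite.exists_max v
  choose τ hτ using fun d => exists_pathsTo_nonempty l (hR d b)
  obtain ⟨dt, hdt⟩ := Finite.exists_max τ
  -- On the window of width `max l` above `max τ` a single path suffices for the bound with this
  -- `c`; from above the window, one step back stays above `max τ`.
  set c := 1 / (v dw * Real.exp (τ dt + l dM)) with hc
  have hden : 0 < v dw * Real.exp (τ dt + l dM) := mul_pos (hv _) (Real.exp_pos _)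
  have hc0 : 0 < c := one_div_pos.2 hden
  have key : ∀ n : ℕ, ∀ d T, τ dt < T → T ≤ τ dt + l dM + n * l dm →
      ∃ s : Finset (Σ n : ℕ, Fin (n + 1) → D),
        ↑s ⊆ pathsTo R l b d T ∧ c * v d * Real.exp T ≤ s.card := by
    have base : ∀ d T, τ dt < T → T ≤ τ dt + l dM →
      ∃ s : Finset (Σ n : ℕ, Fin (n + 1) → D),
        ↑s ⊆ pathsTo R l b d T ∧ c * v d * Real.exp T ≤ s.card := by
      intro d T h1 h2
      obtain ⟨γ, hγ⟩ := hτ d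
      refine ⟨{γ}, ?_, ?_⟩
      · simpa using pathsTo_mono ((hdt d).trans h1.le) hγ
      · rw [Finset.card_singleton, Nat.cast_one, hc, one_div, mul_assoc, inv_mul_le_iff₀ hden,
          mul_one]
        exact mul_le_mul (hdw d) (Real.exp_le_exp.2 h2) (Real.exp_pos _).le (hv _).le
    intro n
    induction n with
    | zero => intro d T h1 h2; exact base d T h1 (by simpa using h2)
    | succ n ih =>
      intro d T h1 h2
      rcases le_or_gt T (τ dt + l dM) with hT | hT
      · exact base d T h1 hT
      · have h3 : ∀ d', ∃ s : Finset (Σ n : ℕ, Fin (n + 1) → D),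
            ↑s ⊆ pathsTo R l b d' (T - l d) ∧
            c * v d' * Real.exp (T - l d) ≤ s.card := fun d' => by
          refine ih d' _ ?_ ?_
          · have := hdM d; linarith
          · have := hdm d; push_cast at h2; linarith
        choose s hs1 hs2 using h3
        refine ⟨(Finset.univ.filter (R d)).biUnion fun d' => (s d').image (consPath d), ?_, ?_⟩
        · intro γ hγ
          simp only [Finset.mem_coe, Finset.mem_biUnion,
              Finset.mem_filter, Finset.mem_univ, true_and, Finset.mem_image] at hγ
          obtain ⟨d', hd', δ, hδ, rfl⟩ := hγ
          exact consPath_mem_pathsTo hd' (hs1 d' hδ)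
        · rw [Finset.card_biUnion]
          · simp only [Finset.card_image_of_injective _ (consPath_injective d)]
            push_cast
            have c4 : Real.exp (l d) * Real.exp (T - l d) = Real.exp T := by
              rw [← Real.exp_add]; congr 1; ring
            calc c * v d * Real.exp T = c * (Real.exp (l d) * v d) * Real.exp (T - l d) := by
                  rw [← c4]; ring
              _ = ∑ d' ∈ Finset.univ.filter (R d), c * v d' * Real.exp (T - l d) := by
                  rw [hlv, ← Finset.sum_filter, Finset.mul_sum, Finset.sum_mul]
              _ ≤ _ := Finset.sum_le_sum fun d' _ => hs2 d'
          · intro d₁ _ d₂ _ hne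
            rw [Function.onFun, Finset.disjoint_left]
            intro γ h1 h2
            simp only [Finset.mem_image] at h1 h2
            obtain ⟨γ₁, h1, rfl⟩ := h1
            obtain ⟨γ₂, h2, h3⟩ := h2
            rw [consPath_injective d h3] at h2
            exact hne ((hs1 _ h1).1.symm.trans (hs1 _ h2).1)
  refine ⟨c * v b, τ dt, mul_pos hc0 (hv b), fun T hT => ?_⟩
  obtain ⟨n, hn⟩ := exists_nat_ge ((T - (τ dt + l dM)) / l dm)
  rw [div_le_iff₀ (hl dm)] at hn
  exact key n b T hT (by linarith)

end PathCounting

/-! ### Entropy from the path counts, and its scaling. -/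

namespace UGraph

variable {V E : Type*} (G : UGraph V E) [DecidableEq V] [DecidableEq E]

theorem closedCycles_eq (l : E → ℝ) (T : ℝ) :
    G.closedCycles l T = ⋃ d, pathsTo (fun d d' => G.adj d d' = 1) (fun d => l d.1) d d T := by
  ext ⟨n, γ⟩
  simp only [closedCycles, pathsTo, Set.mem_ofPred_eq, Set.mem_iUnion]
  constructor
  · rintro ⟨h1, h2⟩
    refine ⟨γ 0, rfl, fun i => ?_, ?_, h2⟩
    · have := h1 i.castSucc
      rwa [Fin.coeSucc_eq_succ] at this
    · have := h1 (Fin.last n)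
      rwa [Fin.last_add_one] at this
  · rintro ⟨d, rfl, h1, h2, h3⟩
    refine ⟨fun i => ?_, h3⟩
    refine Fin.lastCases ?_ (fun j => ?_) i
    · rwa [Fin.last_add_one]
    · rw [Fin.coeSucc_eq_succ]; exact h1 j

/-- The entropy is `1` if the adjacency matrix weighted by `exp (-l)` is irreducible and has a
positive eigenvector for the eigenvalue `1`. -/
theorem hasEntropy_one [Fintype E] [Nonempty E] {l : E → ℝ} (hl : ∀ e, 0 < l e)
    {v : E × Bool → ℝ} (hv : ∀ d, 0 < v d)
    (hlv : ∀ d, Real.exp (l d.1) * v d = ∑ d', if G.adj d d' = 1 then v d' else 0)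
    (hG : ∀ d d', Relation.TransGen (fun d d' => G.adj d d' = 1) d d') :
    G.HasEntropy l 1 := by
  classical
  obtain ⟨b⟩ : Nonempty (E × Bool) := inferInstance
  obtain ⟨C, hC, hup⟩ := exists_pathsTo_subset_card_le (R := fun d d' => G.adj d d' = 1)
    (l := fun d => l d.1) (fun d => hl d.1) hv (fun d => by convert hlv d)
  obtain ⟨c, T₀, hc, hlow⟩ := exists_subset_pathsTo_le_card (R := fun d d' => G.adj d d' = 1)
    (l := fun d => l d.1) (fun d => hl d.1) hv (fun d => by convert hlv d) hG b
  have hcard : 0 < (Fintype.card (E × Bool) : ℝ) := by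
    exact_mod_cast Fintype.card_pos
  have hbound : ∀ T, T₀ < T → c * Real.exp T ≤ (G.closedCycles l T).ncard ∧
      ((G.closedCycles l T).ncard : ℝ) ≤ Fintype.card (E × Bool) * C * Real.exp T := by
    intro T hT
    choose s hs1 hs2 using fun d => hup d d T
    -- The finite cover serves both bounds: `ncard` of an infinite set is `0`, so the lower bound
    -- also needs finiteness.
    have hsub : G.closedCycles l T ⊆ ↑(Finset.univ.biUnion s) := by
      rw [closedCycles_eq]
      refine Set.iUnion_subset fun d => (hs1 d).trans ?_
      exact_mod_cast Finset.subset_biUnion_of_mem s (Finset.mem_univ d)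
    constructor
    · obtain ⟨t, ht1, ht2⟩ := hlow T hT
      refine ht2.trans ?_
      rw [← Set.ncard_coe_finset]
      have : (t : Set (Σ n : ℕ, Fin (n + 1) → E × Bool)) ⊆ G.closedCycles l T := by
        rw [closedCycles_eq]
        exact ht1.trans (Set.subset_iUnion (fun d => pathsTo (fun d d' => G.adj d d' = 1)
          (fun d => l d.1) d d T) b)
      exact_mod_cast Set.ncard_le_ncard this ((Finset.finite_toSet _).subset hsub)
    · have h1 := Set.ncard_le_ncard hsub (Finset.finite_toSet _)
      rw [Set.ncard_coe_finset] at h1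
      have h2 : ((G.closedCycles l T).ncard : ℝ) ≤ ∑ d, ((s d).card : ℝ) := by
        exact_mod_cast h1.trans Finset.card_biUnion_le
      refine h2.trans ((Finset.sum_le_sum fun d _ => hs2 d).trans ?_)
      simp [mul_assoc]
  have hlim : ∀ K : ℝ, Tendsto (fun T : ℝ => (1 / T) * (Real.log K + T)) atTop (𝓝 1) := by
    intro K
    have h1 : Tendsto (fun T : ℝ => (1 / T) * Real.log K + 1) atTop (𝓝 (0 * Real.log K + 1)) := by
      refine Tendsto.add_const _ (Tendsto.mul_const _ ?_)
      exact tendsto_const_nhds.div_atTop tendsto_id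
    rw [zero_mul, zero_add] at h1
    refine h1.congr' ?_
    filter_upwards [eventually_gt_atTop 0] with T hT
    field_simp
  refine tendsto_of_tendsto_of_tendsto_of_le_of_le' (hlim c)
    (hlim (Fintype.card (E × Bool) * C)) ?_ ?_
  · filter_upwards [eventually_gt_atTop 0, eventually_gt_atTop T₀] with T h0 hT
    refine mul_le_mul_of_nonneg_left ?_ (one_div_pos.2 h0).le
    calc Real.log c + T = Real.log (c * Real.exp T) := by
          rw [Real.log_mul hc.ne' (Real.exp_pos _).ne', Real.log_exp]
      _ ≤ _ := Real.log_le_log (by positivity) (hbound T hT).1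
  · filter_upwards [eventually_gt_atTop 0, eventually_gt_atTop T₀] with T h0 hT
    refine mul_le_mul_of_nonneg_left ?_ (one_div_pos.2 h0).le
    calc Real.log _ ≤ Real.log (Fintype.card (E × Bool) * C * Real.exp T) :=
          Real.log_le_log (lt_of_lt_of_le (by positivity) (hbound T hT).1) (hbound T hT).2
      _ = _ := by
          rw [Real.log_mul (by positivity) (Real.exp_pos _).ne', Real.log_exp]

/-- Rescaling the lengths rescales the entropy. -/
theorem HasEntropy.of_smul {G : UGraph V E} {l : E → ℝ} {s h : ℝ} (hs : 0 < s)
    (H : G.HasEntropy (s • l) h) : G.HasEntropy l (s * h) := by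
  have h1 : ∀ T, G.closedCycles (s • l) (s * T) = G.closedCycles l T := by
    intro T
    ext γ
    simp only [closedCycles, Set.mem_ofPred_eq, Pi.smul_apply, smul_eq_mul, ← Finset.mul_sum]
    rw [mul_lt_mul_iff_right₀ hs]
  have h2 : Tendsto (fun T : ℝ => s * T) atTop atTop := tendsto_id.const_mul_atTop hs
  refine ((H.comp h2).const_mul s).congr fun T => ?_
  simp only [Function.comp, h1]
  field_simp

end UGraph

/-! ### Topology and measurability of the subshift. -/

namespace Subshift

variable {ι : Type*} {A : Matrix ι ι ℕ}

@[simp] theorem cons_zero (i : ι) (x : Subshift A) (h : A i (x.1 0) = 1) :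
    (cons i x h).1 0 = i := rfl

@[simp] theorem cons_succ (i : ι) (x : Subshift A) (h : A i (x.1 0) = 1) (n : ℕ) :
    (cons i x h).1 (n + 1) = x.1 n := rfl

@[simp] theorem shift_cons (i : ι) (x : Subshift A) (h : A i (x.1 0) = 1) :
    shift (cons i x h) = x := rfl

theorem measurable_eval_zero [MeasurableSpace ι] : Measurable fun x : Subshift A => x.1 0 :=
  (measurable_pi_apply 0).comp measurable_subtype_coe

variable [TopologicalSpace ι]

theorem continuous_shift : Continuous (shift : Subshift A → Subshift A) :=
  Continuous.subtype_mk (f := fun (x : Subshift A) n => x.1 (n + 1)) (continuous_pi fun n =>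
    (continuous_apply (A := fun _ : ℕ => ι) (n + 1)).comp continuous_subtype_val) _

/-- Composition with the shift. -/
def compShift (h : C(Subshift A, ℝ)) : C(Subshift A, ℝ) := h.comp ⟨shift, continuous_shift⟩

@[simp] theorem compShift_apply (h : C(Subshift A, ℝ)) (x : Subshift A) :
    compShift h x = h x.shift := rfl

/-- In an irreducible subshift, a closed nonempty set that contains all shift preimages of its
points is the whole space. -/
theorem eq_univ_of_cons_mem (hA : ∀ i j, Relation.TransGen (fun i j => A i j = 1) i j)
    {Z : Set (Subshift A)} (hZ : IsClosed Z) (hne : Z.Nonempty)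
    (hcons : ∀ x ∈ Z, ∀ i (h : A i (x.1 0) = 1), cons i x h ∈ Z) : Z = Set.univ := by
  have h0 : ∀ i, ∃ z ∈ Z, z.1 0 = i := by
    intro i
    obtain ⟨x, hx⟩ := hne
    induction hA i (x.1 0) using Relation.TransGen.head_induction_on with
    | single h => exact ⟨_, hcons x hx _ h, rfl⟩
    | head h _ ih =>
      obtain ⟨z, hz, rfl⟩ := ih
      exact ⟨_, hcons z hz _ h, rfl⟩
  -- Points of `Z` that share the first `n + 1` letters with `y`, built by prepending `y₀` to an
  -- approximation of `y.shift`.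
  have hn : ∀ n : ℕ, ∀ y : Subshift A, ∃ z ∈ Z, ∀ k ≤ n, z.1 k = y.1 k := by
    intro n
    induction n with
    | zero =>
      intro y
      obtain ⟨z, hz, h⟩ := h0 (y.1 0)
      exact ⟨z, hz, fun k hk => by rwa [Nat.le_zero.1 hk]⟩
    | succ n ih =>
      intro y
      obtain ⟨z, hz, h⟩ := ih y.shift
      have h1 : A (y.1 0) (z.1 0) = 1 := by rw [h 0 (Nat.zero_le _)]; exact y.2 0
      refine ⟨cons (y.1 0) z h1, hcons z hz _ h1, fun k hk => ?_⟩
      cases k with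
      | zero => rfl
      | succ k => exact h k (Nat.le_of_succ_le_succ hk)
  refine Set.eq_univ_of_forall fun y => ?_
  choose z hz hzy using fun n => hn n y
  refine hZ.mem_of_tendsto (b := atTop) (f := z) ?_ (Eventually.of_forall hz)
  rw [tendsto_subtype_rng, tendsto_pi_nhds]
  intro k
  refine tendsto_const_nhds.congr' ?_
  filter_upwards [eventually_ge_atTop k] with n hnk
  exact (hzy n k hnk).symm

variable [DiscreteTopology ι]

/-- A function of the zeroth letter. -/
def letterFun (A : Matrix ι ι ℕ) (g : ι → ℝ) : C(Subshift A, ℝ) where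
  toFun x := g (x.1 0)
  continuous_toFun := (continuous_of_discreteTopology (f := g)).comp
    ((continuous_apply 0).comp continuous_subtype_val)

@[simp] theorem letterFun_apply (g : ι → ℝ) (x : Subshift A) :
    letterFun A g x = g (x.1 0) := rfl

theorem polishSpace [Finite ι] : PolishSpace (Subshift A) := by
  have h : IsCompact {x : ℕ → ι | ∀ n, A (x n) (x (n + 1)) = 1} :=
    isCompact_iff_compactSpace.mpr (compactSpace A)
  have : Countable ι := inferInstance
  have : PolishSpace ι := inferInstance
  exact h.isClosed.polishSpace

variable [Fintype ι] [MeasurableSpace ι] [DiscreteMeasurableSpace ι]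

theorem borelSpace : BorelSpace (Subshift A) := by
  have : Countable ι := inferInstance
  have : SecondCountableTopology ι := inferInstance
  have : BorelSpace ι := inferInstance
  infer_instance

theorem integrable (m : Measure (Subshift A)) [IsFiniteMeasure m]
    (h : C(Subshift A, ℝ)) : Integrable (fun x => h x) m := by
  have : BorelSpace (Subshift A) := borelSpace
  exact h.continuous.integrable_of_hasCompactSupport (HasCompactSupport.of_compactSpace _)

end Subshift

/-! ### Spectral radius, eigenfunctions and eigenmeasures of transfer operators. -/

/-- The spectrum of a power bounded element lies in the closed unit disc. -/
theorem norm_le_one_of_mem_spectrum {B : Type*} [NormedRing B] [NormedAlgebra ℝ B]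
    [CompleteSpace B] {a : B} {K : ℝ} (ha : ∀ n, ‖a ^ n‖ ≤ K) {k : ℝ} (hk : k ∈ spectrum ℝ a) :
    ‖k‖ ≤ 1 := by
  by_contra! hlt
  obtain ⟨n, hn⟩ := pow_unbounded_of_one_lt (K * ‖(1 : B)‖) hlt
  have h1 := spectrum.norm_le_norm_mul_of_mem (spectrum.pow_mem_pow a n hk)
  rw [norm_pow] at h1
  exact absurd (h1.trans (mul_le_mul_of_nonneg_right (ha n) (norm_nonneg _))) (not_le.2 hn)

/-- A power bounded operator with a nonzero fixed vector has spectral radius `1`. -/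
theorem spectralRadius_eq_one {E : Type*} [NormedAddCommGroup E] [NormedSpace ℝ E]
    [CompleteSpace E] {T : E →L[ℝ] E} {K : ℝ} (hT : ∀ n, ‖T ^ n‖ ≤ K) {u : E} (hu0 : u ≠ 0)
    (hu : T u = u) : spectralRadius ℝ T = 1 := by
  -- Only the real spectrum enters here, so the lower bound comes from the eigenvalue `1` itself and
  -- not from the growth of the powers.
  have hmem : (1 : ℝ) ∈ spectrum ℝ T := by
    rw [spectrum.mem_iff]
    rintro ⟨U, hU⟩
    have h1 : (U : E →L[ℝ] E) u = 0 := by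
      rw [hU]
      simp [hu]
    have h2 : ((↑(U⁻¹) : E →L[ℝ] E) * (U : E →L[ℝ] E)) u = u := by
      rw [Units.inv_mul, one_apply_eq_self]
    rw [mul_apply_eq_comp, h1, map_zero] at h2
    exact hu0 h2.symm
  refine le_antisymm (iSup₂_le fun k hk => ?_) ?_
  · have := norm_le_one_of_mem_spectrum hT hk
    rw [← coe_nnnorm] at this
    exact_mod_cast this
  · refine le_trans ?_ (le_iSup₂ (f := fun (k : ℝ) (_ : k ∈ spectrum ℝ T) =>
      (‖k‖₊ : ENNReal)) 1 hmem)
    simp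

section Transfer

open Subshift

variable {ι : Type*} [TopologicalSpace ι] [DiscreteTopology ι] [Fintype ι] {A : Matrix ι ι ℕ}

theorem transferOp_apply (f w : C(Subshift A, ℝ)) (x : Subshift A) :
    transferOp f w x = ∑ i : ι, if h : A i (x.1 0) = 1 then
      Real.exp (f (cons i x h)) * w (cons i x h) else 0 := rfl

/-- The factor `h ∘ σ` is constant, equal to `h x`, on the shift preimages of `x`. -/
theorem transferOp_mul_compShift (f w h : C(Subshift A, ℝ)) :
    transferOp f (w * compShift h) = transferOp f w * h := by
  ext x
  simp only [transferOp_apply, ContinuousMap.mul_apply, compShift_apply, shift_cons,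
    Finset.sum_mul]
  refine Finset.sum_congr rfl fun i _ => ?_
  split_ifs <;> ring

theorem transferOp_letterFun (F w : ι → ℝ) (x : Subshift A) :
    transferOp (letterFun A F) (letterFun A w) x =
      ∑ i, if A i (x.1 0) = 1 then Real.exp (F i) * w i else 0 := by
  simp [transferOp_apply]

theorem transferOp_nonneg (f : C(Subshift A, ℝ)) {w : C(Subshift A, ℝ)} (hw : ∀ x, 0 ≤ w x)
    (x : Subshift A) : 0 ≤ transferOp f w x := by
  rw [transferOp_apply]
  refine Finset.sum_nonneg fun i _ => ?_
  split_ifs with h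
  · exact mul_nonneg (Real.exp_pos _).le (hw _)
  · exact le_rfl

theorem transferOp_pow_nonneg (f : C(Subshift A, ℝ)) {w : C(Subshift A, ℝ)} (hw : ∀ x, 0 ≤ w x)
    (n : ℕ) (x : Subshift A) : 0 ≤ (transferOp f ^ n) w x := by
  induction n generalizing x with
  | zero => simpa using hw x
  | succ n ih => rw [pow_succ']; exact transferOp_nonneg f ih x

theorem transferOp_pow_eigen {f u : C(Subshift A, ℝ)} (hu : transferOp f u = u) (n : ℕ) :
    (transferOp f ^ n) u = u := by
  induction n with
  | zero => simp
  | succ n ih => rw [pow_succ, mul_apply_eq_comp, hu, ih]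

/-- Positive eigenfunctions of an irreducible transfer operator are unique up to a factor. -/
theorem exists_eq_smul_of_transferOp_eq
    (hA : ∀ i j, Relation.TransGen (fun i j => A i j = 1) i j) [Nonempty (Subshift A)]
    {f u v : C(Subshift A, ℝ)} (hpos : ∀ x, 0 < u x)
    (hu : transferOp f u = u) (hv : transferOp f v = v) : ∃ c : ℝ, v = c • u := by
  obtain ⟨x₀, -, hx₀⟩ := isCompact_univ.exists_isMaxOn (Set.univ_nonempty (α := Subshift A))
    (f := fun x => v x / u x)
    ((v.continuous.div u.continuous fun x => (hpos x).ne').continuousOn)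
  -- Maximum principle: `w = c u - v` is nonnegative, fixed by the operator, and zero at `x₀`. A sum
  -- of nonnegative terms vanishes only termwise, so the zero set of `w` contains all preimages of
  -- its points.
  set c := v x₀ / u x₀ with hc
  set w : C(Subshift A, ℝ) := c • u - v with hw
  have hw0 : ∀ x, 0 ≤ w x := fun x => by
    have : v x / u x ≤ c := hx₀ (Set.mem_univ x)
    rw [div_le_iff₀ (hpos x)] at this
    simpa [hw] using this
  have hLw : transferOp f w = w := by rw [hw, map_sub, map_smul, hu, hv]
  have hZ : {x | w x = 0} = Set.univ := by
    refine eq_univ_of_cons_mem hA (isClosed_eq w.continuous continuous_const) ⟨x₀, ?_⟩ ?_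
    · have := (hpos x₀).ne'
      simp only [hw, hc, Set.mem_ofPred_eq, ContinuousMap.sub_apply, ContinuousMap.smul_apply,
        smul_eq_mul]
      field_simp
      ring
    · intro x hx i hi
      have h1 : transferOp f w x = 0 := by rw [hLw]; exact hx
      rw [transferOp_apply, Finset.sum_eq_zero_iff_of_nonneg] at h1
      · have h2 := h1 i (Finset.mem_univ i)
        rw [dif_pos hi] at h2
        exact (mul_eq_zero.1 h2).resolve_left (Real.exp_pos _).ne'
      · intro j _
        split_ifs with h
        · exact mul_nonneg (Real.exp_pos _).le (hw0 _)
        · exact le_rfl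
  refine ⟨c, ?_⟩
  ext x
  have : w x = 0 := by
    have : x ∈ {x | w x = 0} := by rw [hZ]; trivial
    exact this
  simp only [hw, ContinuousMap.sub_apply] at this
  linarith

variable [Nonempty (Subshift A)]

/-- The iterates of a transfer operator with a positive fixed function are uniformly bounded. -/
theorem exists_norm_transferOp_pow_le {f u : C(Subshift A, ℝ)} (hpos : ∀ x, 0 < u x)
    (hu : transferOp f u = u) : ∃ K : ℝ, 0 < K ∧ ∀ n, ‖transferOp f ^ n‖ ≤ K := by
  obtain ⟨x₀, -, hx₀⟩ := isCompact_univ.exists_isMinOn (Set.univ_nonempty (α := Subshift A))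
    u.continuous.continuousOn
  have hδ : ∀ x, u x₀ ≤ u x := fun x => hx₀ (Set.mem_univ x)
  have hu0 : 0 < ‖u‖ := norm_pos_iff.2 fun h => by
    have := hpos x₀; rw [h] at this; simp at this
  refine ⟨‖u‖ / u x₀, div_pos hu0 (hpos _), fun n => ?_⟩
  refine ContinuousLinearMap.opNorm_le_bound _ (div_pos hu0 (hpos _)).le fun w => ?_
  rw [ContinuousMap.norm_le _ (mul_nonneg (div_pos hu0 (hpos _)).le (norm_nonneg _))]
  intro x
  -- Domination by a multiple of the fixed function, which positivity carries through every iterate.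
  have hw : ∀ y, |w y| ≤ ‖w‖ / u x₀ * u y := fun y => by
    rw [div_mul_eq_mul_div, le_div_iff₀ (hpos _)]
    exact mul_le_mul (w.norm_coe_le_norm y) (hδ y) (hpos _).le (norm_nonneg _)
  have h1x : 0 ≤ (transferOp f ^ n) ((‖w‖ / u x₀) • u - w) x :=
    transferOp_pow_nonneg f (fun y => by
      have := le_of_abs_le (hw y)
      simpa using this) n x
  have h2x : 0 ≤ (transferOp f ^ n) ((‖w‖ / u x₀) • u + w) x :=
    transferOp_pow_nonneg f (fun y => by
      have := neg_le_of_abs_le (hw y)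
      simp only [ContinuousMap.add_apply, ContinuousMap.smul_apply, smul_eq_mul]
      linarith) n x
  simp only [map_sub, map_add, map_smul, transferOp_pow_eigen hu,
    ContinuousMap.add_apply, ContinuousMap.sub_apply, ContinuousMap.smul_apply,
    smul_eq_mul] at h1x h2x
  have h3 : ‖w‖ / u x₀ * u x ≤ ‖u‖ / u x₀ * ‖w‖ := by
    rw [div_mul_eq_mul_div, div_mul_eq_mul_div, mul_comm]
    refine div_le_div_of_nonneg_right ?_ (hpos _).le
    exact mul_le_mul_of_nonneg_right ((le_abs_self _).trans (u.norm_coe_le_norm x))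
      (norm_nonneg _)
  rw [Real.norm_eq_abs, abs_le]
  constructor <;> linarith

theorem perronValue_eq_one {f u : C(Subshift A, ℝ)} (hpos : ∀ x, 0 < u x)
    (hu : transferOp f u = u) : perronValue f = 1 := by
  obtain ⟨K, -, hpow⟩ := exists_norm_transferOp_pow_le hpos hu
  obtain ⟨x₀⟩ : Nonempty (Subshift A) := inferInstance
  have hu0 : u ≠ 0 := by
    rintro rfl
    exact lt_irrefl _ (hpos x₀)
  rw [perronValue, spectralRadius_eq_one hpow hu0 hu, ENNReal.toReal_one]

/-- A positive linear functional that is invariant under a transfer operator with a positive fixed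
function, as a limit of Cesàro means along an ultrafilter. -/
theorem exists_invariant_functional {f u : C(Subshift A, ℝ)} (hpos : ∀ x, 0 < u x)
    (hu : transferOp f u = u) :
    ∃ Λ : C(Subshift A, ℝ) →ₗ[ℝ] ℝ, (∀ φ, (∀ x, 0 ≤ φ x) → 0 ≤ Λ φ) ∧ 0 < Λ u ∧
      ∀ φ, Λ (transferOp f φ) = Λ φ := by
  obtain ⟨K, hK, hpow⟩ := exists_norm_transferOp_pow_le hpos hu
  obtain ⟨x₀⟩ : Nonempty (Subshift A) := inferInstance
  let a : C(Subshift A, ℝ) → ℕ → ℝ := fun φ N =>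
    (∑ n ∈ Finset.range (N + 1), (transferOp f ^ n) φ x₀) / (N + 1)
  have hterm : ∀ φ n, |(transferOp f ^ n) φ x₀| ≤ K * ‖φ‖ := fun φ n =>
    (((transferOp f ^ n) φ).norm_coe_le_norm x₀).trans
      ((transferOp f ^ n).le_of_opNorm_le (hpow n) φ)
  have hbound : ∀ φ N, |a φ N| ≤ K * ‖φ‖ := by
    intro φ N
    have hN : (0 : ℝ) < N + 1 := by positivity
    simp only [a, abs_div, abs_of_pos hN]
    rw [div_le_iff₀ hN]
    refine (Finset.abs_sum_le_sum_abs _ _).trans ?_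
    refine (Finset.sum_le_sum fun n _ => hterm φ n).trans ?_
    simp [mul_comm]
  -- The means stay in a compact interval, so they converge along the ultrafilter; the limit is
  -- linear in `φ` by uniqueness of limits.
  have hlim : ∀ φ, ∃ y, Tendsto (a φ) (hyperfilter ℕ : Filter ℕ) (𝓝 y) := by
    intro φ
    obtain ⟨y, -, hy⟩ := (isCompact_Icc (a := -(K * ‖φ‖)) (b := K * ‖φ‖)).ultrafilter_le_nhds
      ((hyperfilter ℕ).map (a φ)) (by
        rw [Ultrafilter.coe_map, le_principal_iff, mem_map]
        exact Filter.univ_mem' fun N => abs_le.1 (hbound φ N))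
    exact ⟨y, hy⟩
  choose Λ hΛ using hlim
  have hat : (hyperfilter ℕ : Filter ℕ) ≤ atTop := by
    rw [← Nat.cofinite_eq_atTop]; exact hyperfilter_le_cofinite
  refine ⟨⟨⟨Λ, ?_⟩, ?_⟩, ?_, ?_, ?_⟩
  · intro φ ψ
    refine tendsto_nhds_unique (hΛ (φ + ψ)) (((hΛ φ).add (hΛ ψ)).congr fun N => ?_)
    simp only [a, map_add, ContinuousMap.add_apply, Finset.sum_add_distrib, add_div]
  · intro c φ
    refine tendsto_nhds_unique (hΛ (c • φ)) (((hΛ φ).const_mul c).congr fun N => ?_)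
    simp only [a, map_smul, ContinuousMap.smul_apply, smul_eq_mul, ← Finset.mul_sum, mul_div_assoc]
  · intro φ hφ
    refine ge_of_tendsto (hΛ φ) (Eventually.of_forall fun N => ?_)
    exact div_nonneg (Finset.sum_nonneg fun n _ => transferOp_pow_nonneg f hφ n x₀) (by positivity)
  · have : Λ u = u x₀ := by
      refine tendsto_nhds_unique (hΛ u) (tendsto_const_nhds.congr fun N => ?_)
      have hN : (N : ℝ) + 1 ≠ 0 := by positivity
      simp only [a, transferOp_pow_eigen hu, Finset.sum_const, Finset.card_range, nsmul_eq_mul]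
      push_cast
      field_simp
    change 0 < Λ u
    rw [this]
    exact hpos x₀
  · intro φ
    change Λ (transferOp f φ) = Λ φ
    rw [← sub_eq_zero]
    refine tendsto_nhds_unique ((hΛ (transferOp f φ)).sub (hΛ φ)) ?_
    refine Tendsto.mono_left ?_ hat
    have h0 : Tendsto (fun N : ℕ => (2 * (K * ‖φ‖)) * (1 / ((N : ℝ) + 1))) atTop (𝓝 0) := by
      simpa using (tendsto_one_div_add_atTop_nhds_zero_nat (𝕜 := ℝ)).const_mul (2 * (K * ‖φ‖))
    refine squeeze_zero_norm (fun N => ?_) h0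
    have hN : (0 : ℝ) < N + 1 := by positivity
    -- The Cesàro sums telescope, leaving a bounded difference divided by `N + 1`.
    have htel : a (transferOp f φ) N - a φ N =
        ((transferOp f ^ (N + 1)) φ x₀ - φ x₀) / (N + 1) := by
      simp only [a]
      rw [← sub_div, ← Finset.sum_sub_distrib]
      congr 1
      have := Finset.sum_range_sub (fun n => (transferOp f ^ n) φ x₀) (N + 1)
      rw [pow_zero, one_apply_eq_self] at this
      rw [← this]
      refine Finset.sum_congr rfl fun n _ => ?_
      rw [pow_succ, mul_apply_eq_comp]
    rw [htel, Real.norm_eq_abs, abs_div, abs_of_pos hN, mul_one_div]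
    refine div_le_div_of_nonneg_right ?_ hN.le
    have h1 := hterm φ (N + 1)
    have h2 := hterm φ 0
    rw [pow_zero, one_apply_eq_self] at h2
    refine (abs_sub _ _).trans ?_
    linarith

variable [MeasurableSpace ι] [DiscreteMeasurableSpace ι]

/-- Riesz–Markov applied to the invariant functional; every continuous function has compact support
here. Positivity on `u` makes the measure nonzero, so it can be normalized. -/
theorem exists_eigenmeasure {f u : C(Subshift A, ℝ)} (hpos : ∀ x, 0 < u x)
    (hu : transferOp f u = u) :
    ∃ μ : Measure (Subshift A), IsProbabilityMeasure μ ∧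
      ∀ φ : C(Subshift A, ℝ), ∫ x, transferOp f φ x ∂μ = ∫ x, φ x ∂μ := by
  have : BorelSpace (Subshift A) := Subshift.borelSpace
  obtain ⟨Λ, hΛ0, hΛu, hΛ⟩ := exists_invariant_functional hpos hu
  let Λ' : CompactlySupportedContinuousMap (Subshift A) ℝ →ₚ[ℝ] ℝ :=
    { toFun := fun g => Λ g.toContinuousMap
      map_add' := fun g g' => Λ.map_add g.toContinuousMap g'.toContinuousMap
      map_smul' := fun c g => Λ.map_smul c g.toContinuousMap
      monotone' := fun g g' h => by
        have := hΛ0 (g'.toContinuousMap - g.toContinuousMap) (fun x => by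
          have := h x
          simpa using this)
        rw [map_sub] at this
        exact sub_nonneg.1 this }
  let ν := RealRMK.rieszMeasure Λ'
  have hν : ∀ φ : C(Subshift A, ℝ), ∫ x, φ x ∂ν = Λ φ := fun φ =>
    RealRMK.integral_rieszMeasure Λ' ⟨φ, HasCompactSupport.of_compactSpace _⟩
  have hν0 : ν ≠ 0 := by
    intro h
    have := hν u
    rw [h, integral_zero_measure] at this
    exact hΛu.ne this
  have : NeZero ν := ⟨hν0⟩
  refine ⟨(ν Set.univ)⁻¹ • ν, isProbabilityMeasureSMul, fun φ => ?_⟩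
  rw [integral_smul_measure, integral_smul_measure, hν, hν, hΛ]

end Transfer

/-! ### Perron uniqueness for finite matrices. -/

section Perron

variable {ι : Type*} [Fintype ι] {A : Matrix ι ι ℕ}

/-- A positive eigenvector of an irreducible nonnegative matrix is unique up to a factor among all
eigenvectors for its eigenvalue. -/
theorem exists_eq_mul_of_irreducible
    (hA : ∀ i j, Relation.TransGen (fun i j => A i j = 1) i j) {F r p : ι → ℝ}
    (hr : ∀ i, 0 < r i)
    (hr' : ∀ i, ∑ j, (if A i j = 1 then Real.exp (F i) * r j else 0) = r i)
    (hp' : ∀ i, ∑ j, (if A i j = 1 then Real.exp (F i) * p j else 0) = p i) :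
    ∃ c : ℝ, ∀ i, p i = c * r i := by
  rcases isEmpty_or_nonempty ι with hι | hι
  · exact ⟨0, fun i => hι.elim i⟩
  -- The same maximum principle: `c r - p` is nonnegative, vanishes at `k`, and its zeros propagate
  -- along admissible pairs.
  obtain ⟨k, hk⟩ := Finite.exists_max fun i => p i / r i
  set c := p k / r k with hc
  have hw0 : ∀ i, 0 ≤ c * r i - p i := fun i => by
    have := hk i
    rw [div_le_iff₀ (hr i)] at this
    linarith
  have hw : ∀ i, ∑ j, (if A i j = 1 then Real.exp (F i) * (c * r j - p j) else 0) =
      c * r i - p i := fun i => by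
    rw [← hr' i, ← hp' i, Finset.mul_sum, ← Finset.sum_sub_distrib]
    refine Finset.sum_congr rfl fun j _ => ?_
    split_ifs <;> ring
  have hstep : ∀ i j, A i j = 1 → c * r i - p i = 0 → c * r j - p j = 0 := by
    intro i j hij hi
    rw [← hw i, Finset.sum_eq_zero_iff_of_nonneg] at hi
    · have h2 := hi j (Finset.mem_univ j)
      rw [if_pos hij] at h2
      exact (mul_eq_zero.1 h2).resolve_left (Real.exp_pos _).ne'
    · intro j _
      split_ifs with h
      · exact mul_nonneg (Real.exp_pos _).le (hw0 _)
      · exact le_rfl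
  have hk0 : c * r k - p k = 0 := by
    rw [hc, div_mul_cancel₀ _ (hr k).ne', sub_self]
  refine ⟨c, fun i => ?_⟩
  have : c * r i - p i = 0 := by
    induction hA k i with
    | single h => exact hstep _ _ h hk0
    | tail _ h ih => exact hstep _ _ h ih
  linarith

end Perron

/-! ### Equilibrium states of functions of the zeroth letter. -/

open Subshift

variable {ι : Type*} [TopologicalSpace ι] [DiscreteTopology ι] [Fintype ι] {A : Matrix ι ι ℕ}

theorem transferOp_letterFun_eq {F q w w' : ι → ℝ}
    (h : ∀ j, ∑ i, (if A i j = 1 then Real.exp (F i) * (q i * w i) else 0) = q j * w' j) :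
    transferOp (letterFun A F) (letterFun A w * letterFun A q) =
      letterFun A w' * letterFun A q := by
  ext x
  have h1 : letterFun A w * letterFun A q = letterFun A fun i => q i * w i := by
    ext y; simp [mul_comm]
  rw [h1, transferOp_letterFun, h]
  simp [mul_comm]

theorem transferOp_letterFun_self {F q : ι → ℝ}
    (h : ∀ j, ∑ i, (if A i j = 1 then Real.exp (F i) * q i else 0) = q j) :
    transferOp (letterFun A F) (letterFun A q) = letterFun A q := by
  ext x
  rw [transferOp_letterFun, h]
  rfl

/-- Eigenmeasures that agree on functions of the zeroth letter agree on functions of finitely many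
letters. -/
theorem integral_eq_of_eigenmeasure [MeasurableSpace ι] {F : ι → ℝ} {μ ν : Measure (Subshift A)}
    (hμ : ∀ φ : C(Subshift A, ℝ), ∫ x, transferOp (letterFun A F) φ x ∂μ = ∫ x, φ x ∂μ)
    (hν : ∀ φ : C(Subshift A, ℝ), ∫ x, transferOp (letterFun A F) φ x ∂ν = ∫ x, φ x ∂ν)
    (h0 : ∀ g : ι → ℝ, ∫ x, letterFun A g x ∂μ = ∫ x, letterFun A g x ∂ν) (n : ℕ) :
    ∀ φ : C(Subshift A, ℝ), (∀ x y : Subshift A, (∀ k ≤ n, x.1 k = y.1 k) → φ x = φ y) →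
      ∫ x, φ x ∂μ = ∫ x, φ x ∂ν := by
  classical
  induction n with
  | zero =>
    intro φ hφ
    -- The default `0` is used only for letters that start no point of the subshift.
    have h1 : φ = letterFun A fun i =>
        if h : ∃ x : Subshift A, x.1 0 = i then φ h.choose else 0 := by
      ext x
      have hx : ∃ y : Subshift A, y.1 0 = x.1 0 := ⟨x, rfl⟩
      rw [letterFun_apply, dif_pos hx]
      refine hφ _ _ fun k hk => ?_
      rw [Nat.le_zero.1 hk]
      exact hx.choose_spec.symm
    rw [h1]
    exact h0 _
  | succ n ih =>
    intro φ hφ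
    -- Since the weight depends on the zeroth letter alone, applying the operator lowers by one the
    -- number of letters on which `φ` depends.
    rw [← hμ, ← hν]
    refine ih _ fun x y hxy => ?_
    rw [transferOp_apply, transferOp_apply]
    refine Finset.sum_congr rfl fun i _ => ?_
    have h0 := hxy 0 (Nat.zero_le _)
    by_cases h : A i (x.1 0) = 1
    · have h' : A i (y.1 0) = 1 := by rwa [← h0]
      rw [dif_pos h, dif_pos h']
      have : φ (cons i x h) = φ (cons i y h') := hφ _ _ fun k hk => by
        cases k with
        | zero => rfl
        | succ k => exact hxy k (Nat.le_of_succ_le_succ hk)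
      rw [this]
      rfl
    · have h' : ¬ A i (y.1 0) = 1 := by rwa [← h0]
      rw [dif_neg h, dif_neg h']

variable [MeasurableSpace ι] [DiscreteMeasurableSpace ι]

/-- The integral of a function of the zeroth letter is a finite sum. -/
theorem integral_letterFun (m : Measure (Subshift A)) [IsFiniteMeasure m] (g : ι → ℝ) :
    ∫ x, letterFun A g x ∂m = ∑ i, g i * m.real {x | x.1 0 = i} := by
  classical
  have hmeas : ∀ i, MeasurableSet {x : Subshift A | x.1 0 = i} := fun i =>
    measurable_eval_zero (measurableSet_singleton i)
  have h1 : ∀ x : Subshift A, letterFun A g x =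
      ∑ i, g i * Set.indicator {x : Subshift A | x.1 0 = i} 1 x := by
    intro x
    simp [Set.indicator_apply]
  simp_rw [h1]
  rw [integral_finsetSum]
  · refine Finset.sum_congr rfl fun i _ => ?_
    rw [integral_const_mul, integral_indicator_one (hmeas i)]
  · intro i _
    exact ((integrable_const (1 : ℝ)).indicator (hmeas i)).const_mul _

/-- The values on letters of an eigenmeasure of the transfer operator of a function of the zeroth
letter form the Perron eigenvector. -/
theorem eigenmeasure_letter (hA : ∀ i j, Relation.TransGen (fun i j => A i j = 1) i j)
    {F r : ι → ℝ} (hr : ∀ i, 0 < r i)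
    (hr' : ∀ i, ∑ j, (if A i j = 1 then Real.exp (F i) * r j else 0) = r i)
    {μ : Measure (Subshift A)} [IsProbabilityMeasure μ]
    (hμ : ∀ φ : C(Subshift A, ℝ), ∫ x, transferOp (letterFun A F) φ x ∂μ = ∫ x, φ x ∂μ) (i : ι) :
    μ.real {x | x.1 0 = i} = r i / ∑ j, r j := by
  classical
  have hp : ∀ i, ∑ j, (if A i j = 1 then Real.exp (F i) * μ.real {x | x.1 0 = j} else 0) =
      μ.real {x | x.1 0 = i} := by
    intro i
    -- Testing on the indicator of a letter turns the eigenmeasure equation into the right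
    -- eigenvector equation.
    have h1 := hμ (letterFun A (Pi.single i 1))
    have h2 : transferOp (letterFun A F) (letterFun A (Pi.single i 1)) =
        letterFun A fun j => if A i j = 1 then Real.exp (F i) else 0 := by
      ext x
      rw [transferOp_letterFun, Finset.sum_eq_single i]
      · simp
      · intro k _ hk
        simp [hk]
      · simp
    rw [h2, integral_letterFun, integral_letterFun] at h1
    simp only [ite_mul, zero_mul, Pi.single_apply, one_mul, Finset.sum_ite_eq',
      Finset.mem_univ, if_true] at h1
    exact h1
  obtain ⟨c, hc⟩ := exists_eq_mul_of_irreducible hA hr hr' hp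
  have h1 := integral_letterFun μ (fun _ => 1)
  simp only [letterFun_apply, integral_const, probReal_univ, smul_eq_mul, mul_one, one_mul,
    hc] at h1
  have hsum : ∑ j, r j ≠ 0 := fun h => by
    rw [← Finset.mul_sum, h, mul_zero] at h1
    exact one_ne_zero h1
  rw [← Finset.mul_sum] at h1
  rw [hc, eq_div_iff hsum, mul_right_comm, ← h1, one_mul]

/-- The bounded continuous functions of finitely many letters. -/
def finiteLetterAlgebra (A : Matrix ι ι ℕ) :
    StarSubalgebra ℝ (BoundedContinuousFunction (Subshift A) ℝ) where
  carrier := {φ | ∃ n : ℕ, ∀ x y : Subshift A, (∀ k ≤ n, x.1 k = y.1 k) → φ x = φ y}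
  mul_mem' := by
    rintro φ ψ ⟨n, hn⟩ ⟨m, hm⟩
    refine ⟨max n m, fun x y h => ?_⟩
    simp only [BoundedContinuousFunction.mul_apply]
    rw [hn x y fun k hk => h k (hk.trans (le_max_left _ _)),
      hm x y fun k hk => h k (hk.trans (le_max_right _ _))]
  add_mem' := by
    rintro φ ψ ⟨n, hn⟩ ⟨m, hm⟩
    refine ⟨max n m, fun x y h => ?_⟩
    simp only [BoundedContinuousFunction.add_apply]
    rw [hn x y fun k hk => h k (hk.trans (le_max_left _ _)),
      hm x y fun k hk => h k (hk.trans (le_max_right _ _))]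
  algebraMap_mem' := fun c => ⟨0, fun x y _ => rfl⟩
  star_mem' := by
    rintro φ ⟨n, hn⟩
    exact ⟨n, fun x y h => by
      simpa using hn x y h⟩

/-- Measures are determined by the integrals of functions of finitely many letters. -/
theorem Subshift.ext_of_integral_eq {μ ν : Measure (Subshift A)} [IsFiniteMeasure μ]
    [IsFiniteMeasure ν]
    (h : ∀ (n : ℕ) (φ : C(Subshift A, ℝ)),
      (∀ x y : Subshift A, (∀ k ≤ n, x.1 k = y.1 k) → φ x = φ y) →
      ∫ x, φ x ∂μ = ∫ x, φ x ∂ν) : μ = ν := by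
  classical
  have : BorelSpace (Subshift A) := borelSpace
  have : PolishSpace (Subshift A) := Subshift.polishSpace
  refine ext_of_forall_mem_subalgebra_integral_eq_of_polish (𝕜 := ℝ)
    (A := finiteLetterAlgebra A) ?_ ?_
  · intro x y hxy
    obtain ⟨n, hn⟩ : ∃ n, x.1 n ≠ y.1 n := by
      by_contra! hcon
      exact hxy (Subtype.ext (funext hcon))
    let φ : C(Subshift A, ℝ) :=
      ⟨fun z => if z.1 n = x.1 n then 1 else 0,
        (continuous_of_discreteTopology (f := fun i : ι => if i = x.1 n then (1 : ℝ) else 0)).comp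
          ((continuous_apply n).comp continuous_subtype_val)⟩
    refine ⟨φ, ⟨φ, ⟨BoundedContinuousFunction.mkOfCompact φ, ⟨n, fun z z' h => ?_⟩, ?_⟩, rfl⟩, ?_⟩
    · simp [φ, h n le_rfl]
    · rfl
    · simp [φ, hn.symm]
  · rintro g ⟨n, hn⟩
    exact h n g.toContinuousMap hn

/-- The letter values are forced by the Perron eigenvector and the total mass; they propagate to
functions of finitely many letters, which determine the measure. -/
theorem eigenmeasure_unique (hA : ∀ i j, Relation.TransGen (fun i j => A i j = 1) i j)
    {F r : ι → ℝ} (hr : ∀ i, 0 < r i)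
    (hr' : ∀ i, ∑ j, (if A i j = 1 then Real.exp (F i) * r j else 0) = r i)
    {μ ν : Measure (Subshift A)} [IsProbabilityMeasure μ] [IsProbabilityMeasure ν]
    (hμ : ∀ φ : C(Subshift A, ℝ), ∫ x, transferOp (letterFun A F) φ x ∂μ = ∫ x, φ x ∂μ)
    (hν : ∀ φ : C(Subshift A, ℝ), ∫ x, transferOp (letterFun A F) φ x ∂ν = ∫ x, φ x ∂ν) :
    μ = ν := by
  refine Subshift.ext_of_integral_eq (integral_eq_of_eigenmeasure hμ hν fun g => ?_)
  rw [integral_letterFun, integral_letterFun]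
  simp_rw [eigenmeasure_letter hA hr hr' hμ, eigenmeasure_letter hA hr hr' hν]

/-- For a function of the zeroth letter, the eigenfunction in the definition of an equilibrium
state may be taken to be a given positive function of the zeroth letter. -/
theorem isEquilibriumState_letterFun_iff [Nonempty (Subshift A)]
    (hA : ∀ i j, Relation.TransGen (fun i j => A i j = 1) i j)
    {F q : ι → ℝ} (hq : ∀ i, 0 < q i)
    (hq' : ∀ j, ∑ i, (if A i j = 1 then Real.exp (F i) * q i else 0) = q j)
    {m : Measure (Subshift A)} :
    IsEquilibriumState (letterFun A F) m ↔ ∃ μ : Measure (Subshift A), IsProbabilityMeasure μ ∧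
      (∀ φ : C(Subshift A, ℝ), ∫ x, transferOp (letterFun A F) φ x ∂μ = ∫ x, φ x ∂μ) ∧
      m = μ.withDensity fun x => ENNReal.ofReal (letterFun A q x / ∫ y, letterFun A q y ∂μ) := by
  have hu := transferOp_letterFun_self hq'
  have hpos : ∀ x, 0 < letterFun A q x := fun x => hq _
  have h1 : perronValue (letterFun A F) = 1 := perronValue_eq_one hpos hu
  rw [IsEquilibriumState, pressure, h1]
  simp only [Real.log_one, true_and, one_smul, one_mul]
  constructor
  · rintro ⟨v, μ, hv, hLv, hμ, hμL, rfl⟩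
    refine ⟨μ, hμ, hμL, ?_⟩
    -- The factor `c` cancels in `v / ∫ v`.
    obtain ⟨c, rfl⟩ := exists_eq_smul_of_transferOp_eq hA hpos hu hLv
    obtain ⟨x₀⟩ : Nonempty (Subshift A) := inferInstance
    have hc : c ≠ 0 := by
      rintro rfl
      have := hv x₀
      simp at this
    congr 1
    funext x
    congr 1
    simp only [ContinuousMap.smul_apply, smul_eq_mul]
    rw [integral_const_mul, mul_div_mul_left _ _ hc]
  · rintro ⟨μ, hμ, hμL, rfl⟩
    exact ⟨_, μ, hpos, hu, hμ, hμL, rfl⟩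

/-- A function of the zeroth letter with positive eigenvectors on both sides has a unique
equilibrium state. -/
theorem existsUnique_isEquilibriumState [Nonempty (Subshift A)]
    (hA : ∀ i j, Relation.TransGen (fun i j => A i j = 1) i j)
    {F q r : ι → ℝ} (hq : ∀ i, 0 < q i)
    (hq' : ∀ j, ∑ i, (if A i j = 1 then Real.exp (F i) * q i else 0) = q j)
    (hr : ∀ i, 0 < r i)
    (hr' : ∀ i, ∑ j, (if A i j = 1 then Real.exp (F i) * r j else 0) = r i) :
    ∃! m : Measure (Subshift A), IsEquilibriumState (letterFun A F) m := by
  simp only [isEquilibriumState_letterFun_iff hA hq hq']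
  obtain ⟨μ, hμ, hμL⟩ := exists_eigenmeasure (fun x => hq _) (transferOp_letterFun_self hq')
  refine ⟨_, ⟨μ, hμ, hμL, rfl⟩, ?_⟩
  rintro m ⟨ν, hν, hνL, rfl⟩
  rw [eigenmeasure_unique hA hr hr' hμL hνL]

/-- The integral of a continuous function with respect to the equilibrium state. -/
theorem integral_withDensity_letterFun {q : ι → ℝ} (hq : ∀ i, 0 < q i)
    {μ : Measure (Subshift A)} [IsProbabilityMeasure μ] (h : C(Subshift A, ℝ)) :
    ∫ x, h x ∂μ.withDensity
      (fun x => ENNReal.ofReal (letterFun A q x / ∫ y, letterFun A q y ∂μ)) =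
      (∫ x, h x * letterFun A q x ∂μ) / ∫ y, letterFun A q y ∂μ := by
  have hq0 : 0 ≤ ∫ y, letterFun A q y ∂μ := integral_nonneg fun y => (hq _).le
  have : BorelSpace (Subshift A) := borelSpace
  rw [integral_withDensity_eq_integral_toReal_smul]
  · rw [← integral_div]
    refine integral_congr_ae (Eventually.of_forall fun x => ?_)
    have : 0 ≤ letterFun A q x / ∫ y, letterFun A q y ∂μ := div_nonneg (hq _).le hq0
    simp only [ENNReal.toReal_ofReal this, smul_eq_mul]
    ring
  · exact ENNReal.measurable_ofReal.comp
      ((letterFun A q).continuous.measurable.div_const _)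
  · exact Eventually.of_forall fun x => ENNReal.ofReal_lt_top

theorem integral_letterFun_pos {q : ι → ℝ} (hq : ∀ i, 0 < q i)
    (μ : Measure (Subshift A)) [IsProbabilityMeasure μ] : 0 < ∫ y, letterFun A q y ∂μ := by
  rw [integral_pos_iff_support_of_nonneg (f := fun y => letterFun A q y) (fun y => (hq _).le) (integrable μ _)]
  have : Function.support (fun y => letterFun A q y) = Set.univ :=
    Set.eq_univ_of_forall fun y => (hq _).ne'
  rw [this]
  simp

theorem IsEquilibriumState.isProbabilityMeasure [Nonempty (Subshift A)]
    (hA : ∀ i j, Relation.TransGen (fun i j => A i j = 1) i j) {F q : ι → ℝ} (hq : ∀ i, 0 < q i)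
    (hq' : ∀ j, ∑ i, (if A i j = 1 then Real.exp (F i) * q i else 0) = q j)
    {m : Measure (Subshift A)} (hm : IsEquilibriumState (letterFun A F) m) :
    IsProbabilityMeasure m := by
  obtain ⟨μ, hμ, hμL, rfl⟩ := (isEquilibriumState_letterFun_iff hA hq hq').1 hm
  have hpos := integral_letterFun_pos hq μ
  constructor
  rw [withDensity_apply _ MeasurableSet.univ, setLIntegral_univ,
    ← ofReal_integral_eq_lintegral_ofReal ((integrable μ _).div_const _)
      (Eventually.of_forall fun x => div_nonneg (hq _).le hpos.le),
    integral_div, div_self hpos.ne', ENNReal.ofReal_one]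

/-- The duality between composition with the shift and the normalized transfer operator. -/
theorem IsEquilibriumState.integral_mul_compShift [Nonempty (Subshift A)]
    (hA : ∀ i j, Relation.TransGen (fun i j => A i j = 1) i j) {F q : ι → ℝ} (hq : ∀ i, 0 < q i)
    (hq' : ∀ j, ∑ i, (if A i j = 1 then Real.exp (F i) * q i else 0) = q j)
    {m : Measure (Subshift A)} (hm : IsEquilibriumState (letterFun A F) m)
    {w w' : ι → ℝ}
    (h : ∀ j, ∑ i, (if A i j = 1 then Real.exp (F i) * (q i * w i) else 0) = q j * w' j)
    (φ : C(Subshift A, ℝ)) :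
    ∫ x, (letterFun A w * compShift φ) x ∂m = ∫ x, (letterFun A w' * φ) x ∂m := by
  obtain ⟨μ, hμ, hμL, rfl⟩ := (isEquilibriumState_letterFun_iff hA hq hq').1 hm
  rw [integral_withDensity_letterFun hq, integral_withDensity_letterFun hq]
  congr 1
  -- The operator pulls `φ` out of `φ ∘ σ` and sends `w q` to `w' q`.
  have h1 := hμL (letterFun A w * letterFun A q * compShift φ)
  rw [transferOp_mul_compShift, transferOp_letterFun_eq h] at h1
  convert h1.symm using 2
  · funext x; simp only [ContinuousMap.mul_apply]; ring
  · funext x; simp only [ContinuousMap.mul_apply]; ring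

/-- The density is proportional to `q` and the eigenmeasure of a letter to `r`, so the product of
left and right eigenvectors appears. -/
theorem IsEquilibriumState.measureReal_letter [Nonempty (Subshift A)]
    (hA : ∀ i j, Relation.TransGen (fun i j => A i j = 1) i j) {F q : ι → ℝ} (hq : ∀ i, 0 < q i)
    (hq' : ∀ j, ∑ i, (if A i j = 1 then Real.exp (F i) * q i else 0) = q j)
    {m : Measure (Subshift A)} (hm : IsEquilibriumState (letterFun A F) m)
    {r : ι → ℝ} (hr : ∀ i, 0 < r i)
    (hr' : ∀ i, ∑ j, (if A i j = 1 then Real.exp (F i) * r j else 0) = r i) (i : ι) :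
    m.real {x | x.1 0 = i} = q i * r i / ∑ j, q j * r j := by
  classical
  have := hm.isProbabilityMeasure hA hq hq'
  have h1 := integral_letterFun m (Pi.single i 1)
  simp only [Pi.single_apply, ite_mul, one_mul, zero_mul, Finset.sum_ite_eq', Finset.mem_univ,
    if_true] at h1
  rw [← h1]
  obtain ⟨μ, hμ, hμL, rfl⟩ := (isEquilibriumState_letterFun_iff hA hq hq').1 hm
  rw [integral_withDensity_letterFun hq]
  have h2 : ∀ x : Subshift A, letterFun A (Pi.single i 1) x * letterFun A q x =
      letterFun A (Pi.single i (q i)) x := fun x => by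
    simp only [letterFun_apply, Pi.single_apply]
    split_ifs with h
    · rw [h, one_mul]
    · rw [zero_mul]
  simp_rw [h2]
  rw [integral_letterFun, integral_letterFun]
  simp_rw [eigenmeasure_letter hA hr hr' hμL]
  have hs : 0 < ∑ j, r j := Finset.sum_pos (fun j _ => hr j) ⟨i, Finset.mem_univ i⟩
  simp only [Pi.single_apply, ite_mul, zero_mul, Finset.sum_ite_eq', Finset.mem_univ, if_true,
    ← mul_div_assoc, ← Finset.sum_div]
  rw [div_div_div_cancel_right₀ hs.ne']

/-! ### Variance by a martingale decomposition. -/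

section Variance

variable {ι : Type*} [TopologicalSpace ι] [DiscreteTopology ι] {A : Matrix ι ι ℕ}

/-- The approximating sums of a function `ζ x₀ - ζ' x₁`, shifted by a boundary term. -/
def shiftedSum (A : Matrix ι ι ℕ) (ζ ζ' : ι → ℝ) : ℕ → C(Subshift A, ℝ)
  | 0 => letterFun A ζ'
  | n + 1 => letterFun A ζ - compShift (letterFun A ζ') + compShift (shiftedSum A ζ ζ' n)

/-- The function is the reverse martingale difference `ζ x₀ - ζ' x₁` plus the coboundary `ζ' x₁ - ζ'
x₀`. The Birkhoff sum telescopes to the sum of the differences plus `ζ' ∘ σⁿ - ζ'`; `shiftedSum`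
keeps all but the last term. -/
theorem birkhoffSum_eq_shiftedSum_sub (ζ ζ' : ι → ℝ) (n : ℕ) (x : Subshift A) :
    birkhoffSum shift (letterFun A (ζ - ζ')) n x = shiftedSum A ζ ζ' n x - letterFun A ζ' x := by
  induction n generalizing x with
  | zero => simp [shiftedSum]
  | succ n ih =>
    rw [birkhoffSum_succ', ih]
    simp only [shiftedSum, letterFun_apply, Pi.sub_apply, ContinuousMap.add_apply,
      ContinuousMap.sub_apply, compShift_apply]
    ring

variable [Fintype ι] [MeasurableSpace ι] [DiscreteMeasurableSpace ι]

/-- Integration of continuous functions as a linear functional. -/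
def integralFunctional (m : Measure (Subshift A)) [IsFiniteMeasure m] :
    C(Subshift A, ℝ) →ₗ[ℝ] ℝ where
  toFun h := ∫ x, h x ∂m
  map_add' h h' := integral_add (integrable m h) (integrable m h')
  map_smul' c _ := integral_const_mul c _

theorem integralFunctional_mono (m : Measure (Subshift A)) [IsFiniteMeasure m]
    {h h' : C(Subshift A, ℝ)} (hh : ∀ x, h x ≤ h' x) :
    integralFunctional m h ≤ integralFunctional m h' :=
  integral_mono (integrable m h) (integrable m h') hh

/-- The variance of a function `ζ - ζ'` of the zeroth letter, where `ζ'` is the conditional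
expectation of `ζ` given the shift. -/
theorem hasVariance_letterFun {m : Measure (Subshift A)} [IsProbabilityMeasure m] {ζ ζ' : ι → ℝ}
    (hinv : ∀ h : C(Subshift A, ℝ), ∫ x, compShift h x ∂m = ∫ x, h x ∂m)
    (hζ : ∀ h : C(Subshift A, ℝ),
      ∫ x, (letterFun A ζ * compShift h) x ∂m = ∫ x, (letterFun A ζ' * h) x ∂m) :
    HasVariance (letterFun A (ζ - ζ')) m (∑ i, (ζ i ^ 2 - ζ' i ^ 2) * m.real {x | x.1 0 = i}) := by
  set I := integralFunctional m with hI
  set Z := letterFun A ζ with hZ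
  set Z' := letterFun A ζ' with hZ'
  set R := shiftedSum A ζ ζ' with hR
  have hinv' : ∀ h, I (compShift h) = I h := hinv
  have hζ' : ∀ h, I (Z * compShift h) = I (Z' * h) := hζ
  have hmul : ∀ h h' : C(Subshift A, ℝ), compShift (h * h') = compShift h * compShift h' :=
    fun _ _ => rfl
  have hmean : ∫ y, letterFun A (ζ - ζ') y ∂m = 0 := by
    have h1 := hζ' 1
    have h2 : compShift (1 : C(Subshift A, ℝ)) = 1 := rfl
    rw [h2, mul_one, mul_one] at h1
    have h3 : letterFun A (ζ - ζ') = Z - Z' := rfl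
    change I (letterFun A (ζ - ζ')) = 0
    rw [h3, map_sub, h1, sub_self]
  set V := I (Z * Z) - I (Z' * Z') with hV
  set c := I (Z' * Z') with hc
  have hVsum : ∑ i, (ζ i ^ 2 - ζ' i ^ 2) * m.real {x | x.1 0 = i} = V := by
    rw [← integral_letterFun m fun i => ζ i ^ 2 - ζ' i ^ 2, hV, hc, ← map_sub]
    change _ = ∫ x, _ ∂m
    refine integral_congr_ae (Eventually.of_forall fun x => ?_)
    simp [hZ, hZ', sq]
  -- Orthogonality: the martingale difference integrates to zero against every function of the
  -- shifted point.
  have hcross : ∀ h, I ((Z - compShift Z') * compShift h) = 0 := fun h => by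
    rw [sub_mul, map_sub, hζ', ← hmul, hinv', sub_self]
  have hRsq : ∀ n : ℕ, I (R n * R n) = n * V + c := by
    intro n
    induction n with
    | zero => simp [hR, shiftedSum, hc, hZ']
    | succ n ih =>
      have h1 : R (n + 1) * R (n + 1) = Z * Z - Z * compShift Z' -
          (Z - compShift Z') * compShift Z' +
          (2 : ℝ) • ((Z - compShift Z') * compShift (R n)) + compShift (R n * R n) := by
        ext x
        simp only [hR, shiftedSum, ContinuousMap.mul_apply, ContinuousMap.add_apply,
          ContinuousMap.sub_apply, ContinuousMap.smul_apply, smul_eq_mul, compShift_apply]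
        ring
      rw [h1, map_add, map_add, map_sub, map_sub, map_smul, hcross, hcross, hinv', ih, hζ']
      push_cast
      rw [hV]
      simp only [smul_zero, sub_zero, add_zero]
      ring
  -- Removing the boundary term costs `-2 R Z' + Z'²`; the cross term is split by Young's inequality
  -- with weight `δ`.
  have hest : ∀ n : ℕ, ∀ δ : ℝ, 0 < δ →
      |I ((R n - Z') * (R n - Z')) - (n * V + c)| ≤ δ * (n * V + c) + (1 / δ + 1) * c := by
    intro n δ hδ
    have e1 : δ * (n * V + c) + (1 / δ + 1) * c =
        I (δ • (R n * R n) + (1 / δ + 1) • (Z' * Z')) := by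
      rw [map_add, map_smul, map_smul, hRsq, smul_eq_mul, smul_eq_mul]
    rw [e1, ← hRsq, ← map_sub, abs_le, ← map_neg]
    have key : ∀ r z : ℝ, 0 ≤ δ * r ^ 2 + 1 / δ * z ^ 2 - 2 * r * z ∧
        0 ≤ δ * r ^ 2 + 1 / δ * z ^ 2 + 2 * r * z := fun r z => by
      have h1 : δ * r ^ 2 + 1 / δ * z ^ 2 - 2 * r * z = (δ * r - z) ^ 2 / δ := by
        field_simp
        ring
      have h2 : δ * r ^ 2 + 1 / δ * z ^ 2 + 2 * r * z = (δ * r + z) ^ 2 / δ := by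
        field_simp
        ring
      rw [h1, h2]
      exact ⟨by positivity, by positivity⟩
    constructor <;> refine integralFunctional_mono m fun x => ?_
    · have := (key (R n x) (Z' x)).1
      simp only [ContinuousMap.neg_apply, ContinuousMap.mul_apply, ContinuousMap.add_apply,
        ContinuousMap.sub_apply, ContinuousMap.smul_apply, smul_eq_mul]
      nlinarith [sq_nonneg (Z' x)]
    · have := (key (R n x) (Z' x)).2
      simp only [ContinuousMap.mul_apply, ContinuousMap.add_apply,
        ContinuousMap.sub_apply, ContinuousMap.smul_apply, smul_eq_mul]
      nlinarith [sq_nonneg (Z' x)]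
  have hB : ∀ n : ℕ, ∫ x, (birkhoffSum shift (letterFun A (ζ - ζ')) n x -
      n * ∫ y, letterFun A (ζ - ζ') y ∂m) ^ 2 ∂m = I ((R n - Z') * (R n - Z')) := by
    intro n
    rw [hmean]
    change _ = ∫ x, _ ∂m
    refine integral_congr_ae (Eventually.of_forall fun x => ?_)
    simp only [mul_zero, sub_zero, birkhoffSum_eq_shiftedSum_sub, ContinuousMap.mul_apply,
      ContinuousMap.sub_apply]
    rw [sq]
  rw [hVsum, HasVariance]
  simp_rw [hB]
  have hinvn : Tendsto (fun n : ℕ => 1 / (n : ℝ)) atTop (𝓝 0) :=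
    tendsto_one_div_atTop_nhds_zero_nat
  have hsqrt : Tendsto (fun n : ℕ => 1 / Real.sqrt n) atTop (𝓝 0) := by
    refine tendsto_const_nhds.div_atTop ?_
    exact Real.tendsto_sqrt_atTop.comp tendsto_natCast_atTop_atTop
  have hlim : Tendsto (fun n : ℕ => (1 / Real.sqrt n) * (V + c * (1 / (n : ℝ))) +
      c * (1 / Real.sqrt n) + 2 * |c| * (1 / (n : ℝ))) atTop (𝓝 0) := by
    have := ((hsqrt.mul ((hinvn.const_mul c).const_add V)).add (hsqrt.const_mul c)).add
      (hinvn.const_mul (2 * |c|))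
    simpa using this
  rw [tendsto_iff_norm_sub_tendsto_zero]
  refine squeeze_zero' (Eventually.of_forall fun n => norm_nonneg _) ?_ hlim
  filter_upwards [eventually_gt_atTop 0] with n hn
  have hn0 : (0 : ℝ) < n := Nat.cast_pos.2 hn
  have hs : 0 < Real.sqrt n := Real.sqrt_pos.2 hn0
  have hss : Real.sqrt n * Real.sqrt n = n := Real.mul_self_sqrt hn0.le
  -- With `δ = 1/√n` both error terms are of order `√n`, so they vanish after division by `n`.
  have h1 := hest n (1 / Real.sqrt n) (one_div_pos.2 hs)
  have h2 : 1 / (n : ℝ) * I ((R n - Z') * (R n - Z')) - V =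
      1 / (n : ℝ) * ((I ((R n - Z') * (R n - Z')) - (n * V + c)) + c) := by
    field_simp
    ring
  rw [h2, Real.norm_eq_abs, abs_mul, abs_of_pos (one_div_pos.2 hn0)]
  calc 1 / (n : ℝ) * |(I ((R n - Z') * (R n - Z')) - (n * V + c)) + c|
      ≤ 1 / (n : ℝ) * ((1 / Real.sqrt n * (n * V + c) + (1 / (1 / Real.sqrt n) + 1) * c) + |c|) := by
        refine mul_le_mul_of_nonneg_left ((abs_add_le _ _).trans ?_) (one_div_pos.2 hn0).le
        linarith
    _ = (1 / Real.sqrt n) * (V + c * (1 / (n : ℝ))) + c * (Real.sqrt n / n) +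
          (c + |c|) * (1 / (n : ℝ)) := by
        field_simp
        ring
    _ ≤ _ := by
        have h3 : Real.sqrt n / n = 1 / Real.sqrt n := by
          rw [div_eq_div_iff hn0.ne' hs.ne', hss, one_mul]
        rw [h3]
        have := mul_le_mul_of_nonneg_right (show c + |c| ≤ 2 * |c| by linarith [le_abs_self c])
          (one_div_pos.2 hn0).le
        linarith

end Variance

/-! ### The dumbbell: eigenvectors, moduli space, derivatives and variance. -/

section Dumbbell

/-- Every directed edge leads to the bridge and is reached from it, because going round a loop
reverses the direction in which the bridge is crossed next. -/
theorem dumbbell_irreducible (d d' : Fin 3 × Bool) :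
    Relation.TransGen (fun d d' => dumbbell.adj d d' = 1) d d' := by
  have to_bridge : ∀ d, Relation.TransGen (fun d d' => dumbbell.adj d d' = 1) d (2, true) := by
    have h0 : ∀ b, dumbbell.adj (0, b) (2, true) = 1 := by decide
    have h1 : dumbbell.adj (2, false) (0, true) = 1 := by decide
    have h2 : ∀ b, dumbbell.adj (1, b) (2, false) = 1 := by decide
    have h3 : dumbbell.adj (2, true) (1, true) = 1 := by decide
    have t2 : Relation.TransGen (fun d d' => dumbbell.adj d d' = 1) (2, false) (2, true) :=
      .head h1 (.single (h0 _))
    rintro ⟨e, b⟩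
    fin_cases e
    · exact .single (h0 b)
    · exact .head (h2 b) t2
    · cases b
      · exact t2
      · exact .head h3 (.head (h2 _) t2)
  have of_bridge : ∀ d, Relation.TransGen (fun d d' => dumbbell.adj d d' = 1) (2, true) d := by
    have h0 : ∀ b, dumbbell.adj (2, true) (1, b) = 1 := by decide
    have h1 : dumbbell.adj (1, true) (2, false) = 1 := by decide
    have h2 : ∀ b, dumbbell.adj (2, false) (0, b) = 1 := by decide
    have t2 : Relation.TransGen (fun d d' => dumbbell.adj d d' = 1) (2, true) (2, false) :=
      .head (h0 _) (.single h1)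
    rintro ⟨e, b⟩
    fin_cases e
    · exact .tail t2 (h2 b)
    · exact .single (h0 b)
    · cases b
      · exact t2
      · exact to_bridge _
  exact (to_bridge d).trans (of_bridge d')

instance : Nonempty (Subshift dumbbell.adj) :=
  ⟨⟨fun _ => (0, true), fun _ => show dumbbell.adj (0, true) (0, true) = 1 by decide⟩⟩

/-- The right Perron eigenvector of the weighted adjacency matrix of the dumbbell. -/
def dumbbellRight (a b : ℝ) (d : Fin 3 × Bool) : ℝ :=
  ![1 / a, 1 / b, if d.2 then a else b] d.1

/-- The left Perron eigenvector of the weighted adjacency matrix of the dumbbell. -/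
def dumbbellLeft (a b : ℝ) (d : Fin 3 × Bool) : ℝ :=
  ![(1 + a ^ 2) / a, (1 + b ^ 2) / b, if d.2 then 2 / a else 2 / b] d.1

theorem dumbbellRight_pos {a b : ℝ} (ha : 0 < a) (hb : 0 < b) (d : Fin 3 × Bool) :
    0 < dumbbellRight a b d := by
  obtain ⟨e, c⟩ := d
  fin_cases e <;> cases c <;> simp [dumbbellRight, ha, hb]

theorem dumbbellLeft_pos {a b : ℝ} (ha : 0 < a) (hb : 0 < b) (d : Fin 3 × Bool) :
    0 < dumbbellLeft a b d := by
  obtain ⟨e, c⟩ := d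
  fin_cases e <;> cases c <;> simp [dumbbellLeft] <;> positivity

theorem sum_dumbbell_edges (g : Fin 3 × Bool → ℝ) :
    ∑ d, g d = g (0, true) + g (0, false) + (g (1, true) + g (1, false)) +
      (g (2, true) + g (2, false)) := by
  simp [Fintype.sum_prod_type, Fin.sum_univ_three]

theorem dumbbell_sum_successors (g : Fin 3 × Bool → ℝ) (d : Fin 3 × Bool) :
    ∑ d', (if dumbbell.adj d d' = 1 then g d' else 0) =
      ![g (0, d.2) + g (2, true), g (1, d.2) + g (2, false),
        if d.2 then g (1, true) + g (1, false) else g (0, true) + g (0, false)] d.1 := by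
  rw [sum_dumbbell_edges]
  obtain ⟨e, c⟩ := d
  fin_cases e <;> cases c <;>
    simp [UGraph.adj, UGraph.start, UGraph.finish, UGraph.rev, dumbbell]

theorem dumbbell_sum_predecessors (g : Fin 3 × Bool → ℝ) (d : Fin 3 × Bool) :
    ∑ d', (if dumbbell.adj d' d = 1 then g d' else 0) =
      ![g (0, d.2) + g (2, false), g (1, d.2) + g (2, true),
        if d.2 then g (0, true) + g (0, false) else g (1, true) + g (1, false)] d.1 := by
  rw [sum_dumbbell_edges]
  obtain ⟨e, c⟩ := d
  fin_cases e <;> cases c <;>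
    simp [UGraph.adj, UGraph.start, UGraph.finish, UGraph.rev, dumbbell]

variable {a b : ℝ} {l : Fin 3 → ℝ}

theorem dumbbellRight_eigen (ha : 0 < a) (hb : 0 < b) (h0 : Real.exp (l 0) = 1 + a ^ 2)
    (h1 : Real.exp (l 1) = 1 + b ^ 2) (h2 : Real.exp (l 2) = 2 / (a * b)) (d : Fin 3 × Bool) :
    Real.exp (l d.1) * dumbbellRight a b d =
      ∑ d', (if dumbbell.adj d d' = 1 then dumbbellRight a b d' else 0) := by
  rw [dumbbell_sum_successors]
  obtain ⟨e, c⟩ := d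
  fin_cases e <;> cases c <;> simp [dumbbellRight, h0, h1, h2] <;> field_simp <;> ring

theorem dumbbellRight_eigen' (ha : 0 < a) (hb : 0 < b) (h0 : Real.exp (l 0) = 1 + a ^ 2)
    (h1 : Real.exp (l 1) = 1 + b ^ 2) (h2 : Real.exp (l 2) = 2 / (a * b)) (d : Fin 3 × Bool) :
    ∑ d', (if dumbbell.adj d d' = 1 then Real.exp (-l d.1) * dumbbellRight a b d' else 0) =
      dumbbellRight a b d := by
  have h := dumbbellRight_eigen ha hb h0 h1 h2 d
  simp_rw [← mul_ite_zero]
  rw [← Finset.mul_sum, ← h, ← mul_assoc, ← Real.exp_add, neg_add_cancel, Real.exp_zero, one_mul]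

/-- Reversal of all edges transposes the adjacency matrix, so `exp (l d)` times the right
eigenvector at the reversed edge is a left eigenvector. The loop values do not depend on direction;
those of the bridge are exchanged. -/
theorem dumbbellLeft_eigen (ha : 0 < a) (hb : 0 < b) (h0 : Real.exp (l 0) = 1 + a ^ 2)
    (h1 : Real.exp (l 1) = 1 + b ^ 2) (h2 : Real.exp (l 2) = 2 / (a * b)) (d : Fin 3 × Bool) :
    ∑ d', (if dumbbell.adj d' d = 1 then Real.exp (-l d'.1) * dumbbellLeft a b d' else 0) =
      dumbbellLeft a b d := by
  rw [dumbbell_sum_predecessors fun d' => Real.exp (-l d'.1) * dumbbellLeft a b d']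
  obtain ⟨e, c⟩ := d
  fin_cases e <;> cases c <;> simp [dumbbellLeft, Real.exp_neg, h0, h1, h2] <;> field_simp <;> ring

theorem dumbbell_sum_left_mul_right (ha : 0 < a) (hb : 0 < b) :
    ∑ d, dumbbellLeft a b d * dumbbellRight a b d =
      2 * (a ^ 2 + b ^ 2 + 4 * a ^ 2 * b ^ 2) / (a ^ 2 * b ^ 2) := by
  rw [sum_dumbbell_edges]
  simp [dumbbellLeft, dumbbellRight]
  field_simp
  ring

theorem dumbbell_hasEntropy (hl : ∀ e, 0 < l e)
    (h : Real.exp (2 * l 2) * ((Real.exp (l 0) - 1) * (Real.exp (l 1) - 1)) = 4) :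
    dumbbell.HasEntropy l 1 := by
  have hX : 0 < Real.exp (l 0) - 1 := sub_pos.2 (Real.one_lt_exp_iff.2 (hl 0))
  have hY : 0 < Real.exp (l 1) - 1 := sub_pos.2 (Real.one_lt_exp_iff.2 (hl 1))
  have ha := Real.sqrt_pos.2 hX
  have hb := Real.sqrt_pos.2 hY
  have ha2 := Real.sq_sqrt hX.le
  have hb2 := Real.sq_sqrt hY.le
  refine dumbbell.hasEntropy_one hl (dumbbellRight_pos ha hb)
    (dumbbellRight_eigen ha hb ?_ ?_ ?_) dumbbell_irreducible
  · rw [ha2]; ring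
  · rw [hb2]; ring
  · rw [eq_div_iff (mul_pos ha hb).ne']
    -- Both sides are nonnegative, so it suffices to compare squares, where `a²` and `b²` are known.
    refine (pow_left_inj₀ (by positivity) (by norm_num) two_ne_zero).1 ?_
    rw [mul_pow, mul_pow, ha2, hb2, ← Real.exp_nat_mul]
    push_cast
    rw [h]
    norm_num

theorem dumbbell_surface_iff (hl : ∀ e, 0 < l e) :
    Real.exp (2 * l 2) * ((Real.exp (l 0) - 1) * (Real.exp (l 1) - 1)) = 4 ↔
      l 2 = dumbbellS (l 0) (l 1) := by
  have hX : 0 < Real.exp (l 0) - 1 := sub_pos.2 (Real.one_lt_exp_iff.2 (hl 0))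
  have hY : 0 < Real.exp (l 1) - 1 := sub_pos.2 (Real.one_lt_exp_iff.2 (hl 1))
  have hP := mul_pos hX hY
  have h4 : Real.log 4 = 2 * Real.log 2 := by
    rw [show (4 : ℝ) = 2 ^ 2 by norm_num, Real.log_pow]; norm_num
  rw [← Real.log_injOn_pos.eq_iff (mul_pos (Real.exp_pos _) hP) (by norm_num : (0 : ℝ) < 4),
    Real.log_mul (Real.exp_pos _).ne' hP.ne', Real.log_exp, h4, dumbbellS]
  constructor <;> intro h <;> linarith

theorem dumbbellLength_pos {x y : ℝ} (h : (x, y) ∈ dumbbellDomain) (e : Fin 3) :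
    0 < dumbbellLength x y e := by
  obtain ⟨hx, hy, hxy⟩ := h
  simp only at hx hy hxy
  have hX : 0 < Real.exp x - 1 := sub_pos.2 (Real.one_lt_exp_iff.2 hx)
  have hY : 0 < Real.exp y - 1 := sub_pos.2 (Real.one_lt_exp_iff.2 hy)
  fin_cases e
  · exact hx
  · exact hy
  · have h4 : Real.log 4 = 2 * Real.log 2 := by
      rw [show (4 : ℝ) = 2 ^ 2 by norm_num, Real.log_pow]; norm_num
    have := Real.log_lt_log (mul_pos hX hY) hxy
    change 0 < dumbbellS x y
    rw [dumbbellS]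
    linarith

/-- Brings any positive weighting onto the surface, where its entropy is known; this yields the
inclusion of the moduli space in the surface. -/
theorem exists_scale_dumbbell_surface (hl : ∀ e, 0 < l e) :
    ∃ s : ℝ, 0 < s ∧
      Real.exp (2 * (s * l 2)) * ((Real.exp (s * l 0) - 1) * (Real.exp (s * l 1) - 1)) = 4 := by
  set g : ℝ → ℝ := fun s =>
    Real.exp (2 * (s * l 2)) * ((Real.exp (s * l 0) - 1) * (Real.exp (s * l 1) - 1)) with hg
  have hgc : Continuous g := by fun_prop
  have h00 : g 0 = 0 := by simp [hg]
  have h01 := mul_pos (hl 0) (hl 1)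
  -- With `e^t - 1 ≥ t` the product of the two loop factors at `M` is at least `M² l₀ l₁ = 4`.
  set M := 2 / Real.sqrt (l 0 * l 1) with hM
  have hM0 : 0 < M := div_pos two_pos (Real.sqrt_pos.2 h01)
  have hM4 : (M * l 0) * (M * l 1) = 4 := by
    have : M ^ 2 * (l 0 * l 1) = 4 := by
      rw [hM, div_pow, Real.sq_sqrt h01.le, div_mul_cancel₀ _ h01.ne']
      norm_num
    linarith
  have hgM : 4 ≤ g M := by
    have e0 := Real.add_one_le_exp (M * l 0)
    have e1 := Real.add_one_le_exp (M * l 1)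
    have p0 := mul_pos hM0 (hl 0)
    have p1 := mul_pos hM0 (hl 1)
    have e2 : 1 ≤ Real.exp (2 * (M * l 2)) :=
      Real.one_le_exp (by have := mul_pos hM0 (hl 2); linarith)
    have e3 : 4 ≤ (Real.exp (M * l 0) - 1) * (Real.exp (M * l 1) - 1) := by
      rw [← hM4]
      exact mul_le_mul (by linarith) (by linarith) p1.le (by linarith)
    calc (4 : ℝ) ≤ 1 * ((Real.exp (M * l 0) - 1) * (Real.exp (M * l 1) - 1)) := by linarith
      _ ≤ g M := mul_le_mul_of_nonneg_right e2 (by linarith)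
  obtain ⟨s, hs, hgs⟩ := intermediate_value_Icc hM0.le hgc.continuousOn
    (show (4 : ℝ) ∈ Set.Icc (g 0) (g M) from ⟨by rw [h00]; norm_num, hgM⟩)
  refine ⟨s, lt_of_le_of_ne hs.1 ?_, hgs⟩
  rintro rfl
  rw [h00] at hgs
  norm_num at hgs

/-- The moduli space of the dumbbell is the graph of `S` over the domain. -/
theorem dumbbell_moduliSpace_eq :
    dumbbell.moduliSpace = (fun q : ℝ × ℝ => dumbbellLength q.1 q.2) '' dumbbellDomain := by
  ext l
  constructor
  · rintro ⟨hl, hent⟩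
    -- The weighting `s • l` has entropy `1`, so `l` has entropy `s`; uniqueness of the limit gives
    -- `s = 1`.
    obtain ⟨s, hs, hsurf⟩ := exists_scale_dumbbell_surface hl
    have h1 : dumbbell.HasEntropy (s • l) 1 :=
      dumbbell_hasEntropy (fun e => mul_pos hs (hl e)) hsurf
    have h2 := h1.of_smul hs
    have h3 : s = 1 := by
      have := tendsto_nhds_unique h2 hent
      rwa [mul_one] at this
    subst h3
    simp only [one_mul] at hsurf
    have hS := (dumbbell_surface_iff hl).1 hsurf
    refine ⟨(l 0, l 1), ⟨hl 0, hl 1, ?_⟩, ?_⟩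
    · have hX : 0 < Real.exp (l 0) - 1 := sub_pos.2 (Real.one_lt_exp_iff.2 (hl 0))
      have hY : 0 < Real.exp (l 1) - 1 := sub_pos.2 (Real.one_lt_exp_iff.2 (hl 1))
      have hP := mul_pos hX hY
      have : 1 < Real.exp (2 * l 2) := Real.one_lt_exp_iff.2 (by linarith [hl 2])
      simp only
      nlinarith
    · funext e
      fin_cases e
      · rfl
      · rfl
      · exact hS.symm
  · rintro ⟨⟨x, y⟩, hxy, rfl⟩
    exact ⟨dumbbellLength_pos hxy, dumbbell_hasEntropy (dumbbellLength_pos hxy)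
      ((dumbbell_surface_iff (dumbbellLength_pos hxy)).2 rfl)⟩

theorem hasDerivAt_dumbbellS_left {x : ℝ} (y : ℝ) (hx : 0 < x) (hy : 0 < y) :
    HasDerivAt (fun s => dumbbellS s y) (-(1 / 2) * (Real.exp x / (Real.exp x - 1))) x := by
  have hX : 0 < Real.exp x - 1 := sub_pos.2 (Real.one_lt_exp_iff.2 hx)
  have hY : 0 < Real.exp y - 1 := sub_pos.2 (Real.one_lt_exp_iff.2 hy)
  have h1 := ((((Real.hasDerivAt_exp x).sub_const 1).mul_const (Real.exp y - 1)).log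
    (mul_pos hX hY).ne').const_mul (1 / 2)
  refine (h1.const_sub (Real.log 2)).congr_deriv ?_
  field_simp

theorem dumbbellS_comm (x y : ℝ) : dumbbellS x y = dumbbellS y x := by
  rw [dumbbellS, dumbbellS, mul_comm (Real.exp x - 1)]

theorem hasDerivAt_dumbbellS_right (x : ℝ) {y : ℝ} (hx : 0 < x) (hy : 0 < y) :
    HasDerivAt (fun s => dumbbellS x s) (-(1 / 2) * (Real.exp y / (Real.exp y - 1))) y := by
  simp_rw [dumbbellS_comm x]
  exact hasDerivAt_dumbbellS_left x hy hx

theorem iteratedDeriv_two_dumbbellS_left {x y : ℝ} (hx : 0 < x) (hy : 0 < y) :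
    iteratedDeriv 2 (fun s => dumbbellS s y) x =
      1 / 2 * (Real.exp x / (Real.exp x - 1) ^ 2) := by
  have hX : 0 < Real.exp x - 1 := sub_pos.2 (Real.one_lt_exp_iff.2 hx)
  rw [iteratedDeriv_succ, iteratedDeriv_one]
  have h1 : deriv (fun s => dumbbellS s y) =ᶠ[𝓝 x]
      fun s => -(1 / 2) * (Real.exp s / (Real.exp s - 1)) := by
    filter_upwards [lt_mem_nhds hx] with s hs
    exact (hasDerivAt_dumbbellS_left y hs hy).deriv
  rw [h1.deriv_eq]
  have h2 := (((Real.hasDerivAt_exp x).div ((Real.hasDerivAt_exp x).sub_const 1) hX.ne')).const_mul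
    (-(1 / 2))
  refine h2.deriv.trans ?_
  field_simp
  ring

theorem iteratedDeriv_two_dumbbellS_right {x y : ℝ} (hx : 0 < x) (hy : 0 < y) :
    iteratedDeriv 2 (fun s => dumbbellS x s) y =
      1 / 2 * (Real.exp y / (Real.exp y - 1) ^ 2) := by
  simp_rw [dumbbellS_comm x]
  exact iteratedDeriv_two_dumbbellS_left hy hx

theorem hasDerivAt_dumbbellLength_left {x y : ℝ} (hx : 0 < x) (hy : 0 < y) :
    HasDerivAt (fun s => dumbbellLength s y)
      ![1, 0, -(1 / 2) * (Real.exp x / (Real.exp x - 1))] x := by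
  rw [hasDerivAt_pi]
  intro e
  fin_cases e
  · exact hasDerivAt_id x
  · exact hasDerivAt_const x y
  · exact hasDerivAt_dumbbellS_left y hx hy

theorem hasDerivAt_dumbbellLength_right {x y : ℝ} (hx : 0 < x) (hy : 0 < y) :
    HasDerivAt (fun s => dumbbellLength x s)
      ![0, 1, -(1 / 2) * (Real.exp y / (Real.exp y - 1))] y := by
  rw [hasDerivAt_pi]
  intro e
  fin_cases e
  · exact hasDerivAt_const y x
  · exact hasDerivAt_id y
  · exact hasDerivAt_dumbbellS_right x hx hy

/-- The first fundamental form of the pressure metric of the dumbbell, for the lengths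
`log (1 + a ^ 2)`, `log (1 + b ^ 2)` of the loops. -/
theorem dumbbell_hasVariance {a b : ℝ} {l : Fin 3 → ℝ} (ha : 0 < a) (hb : 0 < b)
    (h0 : Real.exp (l 0) = 1 + a ^ 2) (h1 : Real.exp (l 1) = 1 + b ^ 2)
    (h2 : Real.exp (l 2) = 2 / (a * b)) {m : Measure (Subshift dumbbell.adj)}
    (hm : IsEquilibriumState (letterFun dumbbell.adj fun d => -l d.1) m) (s t : ℝ) :
    ∫ x, dumbbell.edgeFun
      ![s, t, -(s * ((1 + a ^ 2) / a ^ 2) + t * ((1 + b ^ 2) / b ^ 2)) / 2] x ∂m = 0 ∧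
    HasVariance (dumbbell.edgeFun
      ![s, t, -(s * ((1 + a ^ 2) / a ^ 2) + t * ((1 + b ^ 2) / b ^ 2)) / 2]) m
      ((1 + a ^ 2) * b ^ 2 / (a ^ 2 * (a ^ 2 + b ^ 2 + 4 * a ^ 2 * b ^ 2)) * s ^ 2 +
        a ^ 2 * (1 + b ^ 2) / (b ^ 2 * (a ^ 2 + b ^ 2 + 4 * a ^ 2 * b ^ 2)) * t ^ 2) := by
  have hq := dumbbellLeft_pos ha hb
  have hq' := dumbbellLeft_eigen ha hb h0 h1 h2
  have hr := dumbbellRight_pos ha hb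
  have hr' := dumbbellRight_eigen' ha hb h0 h1 h2
  have hprob := hm.isProbabilityMeasure dumbbell_irreducible hq hq'
  have hletter := hm.measureReal_letter dumbbell_irreducible hq hq' hr hr'
  have hdual := fun (w w' : Fin 3 × Bool → ℝ) => hm.integral_mul_compShift (w := w) (w' := w')
    dumbbell_irreducible hq hq'
  rw [dumbbell_sum_left_mul_right ha hb] at hletter
  -- `A` and `B` are `s` and `t` times the mean number of turns per visit to the respective loop.
  set A := s * ((1 + a ^ 2) / a ^ 2) with hA
  set B := t * ((1 + b ^ 2) / b ^ 2) with hB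
  -- The solution of the Poisson equation `ζ - ζ' = φ`, where `q ζ'` is the image of `q ζ` under the
  -- operator, normalized to vanish on the bridge travelled towards the first vertex.
  set ζ : Fin 3 × Bool → ℝ := fun d => ![A, (A + B) / 2, if d.2 then (A - B) / 2 else 0] d.1
    with hζ
  set ζ' : Fin 3 × Bool → ℝ := fun d => ![A - s, (A + B) / 2 - t, if d.2 then A else (A + B) / 2] d.1
    with hζ'
  have hφ : dumbbell.edgeFun ![s, t, -(A + B) / 2] = letterFun dumbbell.adj (ζ - ζ') := by
    ext x
    change (![s, t, -(A + B) / 2] : Fin 3 → ℝ) (x.1 0).1 = (ζ - ζ') (x.1 0)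
    generalize x.1 0 = d
    obtain ⟨e, c⟩ := d
    fin_cases e <;> cases c <;> simp [hζ, hζ'] <;> ring
  rw [hφ]
  have hP : 0 < a ^ 2 + b ^ 2 + 4 * a ^ 2 * b ^ 2 := by positivity
  constructor
  · rw [integral_letterFun]
    simp_rw [hletter]
    rw [sum_dumbbell_edges]
    simp [hζ, hζ', hA, hB, dumbbellLeft, dumbbellRight]
    field_simp
    ring
  · have hinv : ∀ h : C(Subshift dumbbell.adj, ℝ), ∫ x, compShift h x ∂m = ∫ x, h x ∂m := by
      intro h
      have h3 := hdual (fun _ => 1) (fun _ => 1) (fun j => by simpa using hq' j) h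
      have h4 : letterFun dumbbell.adj (fun _ => (1 : ℝ)) = 1 := rfl
      rwa [h4, one_mul, one_mul] at h3
    have hd : ∀ h : C(Subshift dumbbell.adj, ℝ),
        ∫ x, (letterFun dumbbell.adj ζ * compShift h) x ∂m =
          ∫ x, (letterFun dumbbell.adj ζ' * h) x ∂m := by
      refine hdual ζ ζ' fun d => ?_
      rw [dumbbell_sum_predecessors fun d' => Real.exp (-l d'.1) * (dumbbellLeft a b d' * ζ d')]
      obtain ⟨e, c⟩ := d
      fin_cases e <;> cases c <;>
        simp [hζ, hζ', hA, hB, dumbbellLeft, Real.exp_neg, h0, h1, h2] <;> field_simp <;> ring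
    convert hasVariance_letterFun hinv hd using 1
    simp_rw [hletter]
    rw [sum_dumbbell_edges]
    simp [hζ, hζ', hA, hB, dumbbellLeft, dumbbellRight]
    field_simp
    ring

theorem edgeFun_mem_tangentSpace {φ : Fin 3 → ℝ} {m : Measure (Subshift dumbbell.adj)}
    (h : ∫ x, dumbbell.edgeFun φ x ∂m = 0) : dumbbell.edgeFun φ ∈ dumbbell.tangentSpace m :=
  ⟨⟨fun d => φ d.1, fun _ => rfl⟩, h⟩

end Dumbbell

end

/-! ### The proposition. -/

theorem proposition4p6 :
    dumbbell.moduliSpace = (fun q : ℝ × ℝ => dumbbellLength q.1 q.2) '' dumbbellDomain ∧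
    ∀ x y : ℝ, (x, y) ∈ dumbbellDomain →
      DifferentiableAt ℝ (fun s => dumbbellLength s y) x ∧
      DifferentiableAt ℝ (fun s => dumbbellLength x s) y ∧
      (∃! m : Measure (Subshift dumbbell.adj),
        IsEquilibriumState (-dumbbell.edgeFun (dumbbellLength x y)) m) ∧
      ∀ m : Measure (Subshift dumbbell.adj),
        IsEquilibriumState (-dumbbell.edgeFun (dumbbellLength x y)) m →
        dumbbell.edgeFun (dumbbellDx x y) ∈ dumbbell.tangentSpace m ∧
        dumbbell.edgeFun (dumbbellDy x y) ∈ dumbbell.tangentSpace m ∧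
        ∃ EP FP GP VP : ℝ,
          HasVariance (dumbbell.edgeFun (dumbbellDx x y)) m EP ∧
          EP = 2 * iteratedDeriv 2 (fun s => dumbbellS s y) x * m.real {e | e.1 0 = (2, true)} ∧
          EP = Real.exp x * (Real.exp y - 1) /
            ((Real.exp x - 1) *
              (4 * Real.exp (x + y) - 3 * Real.exp x - 3 * Real.exp y + 2)) ∧
          HasVariance (dumbbell.edgeFun (dumbbellDx x y + dumbbellDy x y)) m VP ∧
          FP = 1 / 2 * (VP - EP - GP) ∧
          FP = 0 ∧
          HasVariance (dumbbell.edgeFun (dumbbellDy x y)) m GP ∧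
          GP = 2 * iteratedDeriv 2 (fun s => dumbbellS x s) y * m.real {e | e.1 0 = (2, true)} ∧
          GP = (Real.exp x - 1) * Real.exp y /
            ((Real.exp y - 1) *
              (4 * Real.exp (x + y) - 3 * Real.exp x - 3 * Real.exp y + 2)) ∧
          ∀ a b : ℝ, HasVariance (dumbbell.edgeFun (a • dumbbellDx x y + b • dumbbellDy x y)) m
            (EP * a ^ 2 + 2 * FP * a * b + GP * b ^ 2) := by
  refine ⟨dumbbell_moduliSpace_eq, fun x y hxy => ?_⟩
  have hl := dumbbellLength_pos hxy
  have hsurf := (dumbbell_surface_iff hl).2 rfl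
  have hx : 0 < x := hxy.1
  have hy : 0 < y := hxy.2.1
  have hX : 0 < Real.exp x - 1 := sub_pos.2 (Real.one_lt_exp_iff.2 hx)
  have hY : 0 < Real.exp y - 1 := sub_pos.2 (Real.one_lt_exp_iff.2 hy)
  have dx := hasDerivAt_dumbbellLength_left hx hy
  have dy := hasDerivAt_dumbbellLength_right hx hy
  obtain ⟨a, ha, ha2⟩ : ∃ a, 0 < a ∧ a ^ 2 = Real.exp x - 1 :=
    ⟨_, Real.sqrt_pos.2 hX, Real.sq_sqrt hX.le⟩
  obtain ⟨b, hb, hb2⟩ : ∃ b, 0 < b ∧ b ^ 2 = Real.exp y - 1 :=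
    ⟨_, Real.sqrt_pos.2 hY, Real.sq_sqrt hY.le⟩
  have hexpx : Real.exp x = 1 + a ^ 2 := by rw [ha2]; ring
  have hexpy : Real.exp y = 1 + b ^ 2 := by rw [hb2]; ring
  have h2 : Real.exp (dumbbellLength x y 2) = 2 / (a * b) := by
    rw [eq_div_iff (mul_pos ha hb).ne']
    refine (pow_left_inj₀ (by positivity) (by norm_num) two_ne_zero).1 ?_
    rw [mul_pow, mul_pow, ha2, hb2, ← Real.exp_nat_mul]
    push_cast
    refine hsurf.trans ?_
    norm_num
  have hf : -dumbbell.edgeFun (dumbbellLength x y) =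
      Subshift.letterFun dumbbell.adj fun d => -dumbbellLength x y d.1 := rfl
  have hDx : dumbbellDx x y = ![1, 0, -(1 / 2) * ((1 + a ^ 2) / a ^ 2)] := by
    rw [dumbbellDx, dx.deriv, ← ha2, hexpx]
  have hDy : dumbbellDy x y = ![0, 1, -(1 / 2) * ((1 + b ^ 2) / b ^ 2)] := by
    rw [dumbbellDy, dy.deriv, ← hb2, hexpy]
  have hcomb : ∀ s t : ℝ, s • dumbbellDx x y + t • dumbbellDy x y =
      ![s, t, -(s * ((1 + a ^ 2) / a ^ 2) + t * ((1 + b ^ 2) / b ^ 2)) / 2] := by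
    intro s t
    rw [hDx, hDy]
    funext e
    fin_cases e
    · simp
    · simp
    · simp
      ring
  rw [hf]
  refine ⟨dx.differentiableAt, dy.differentiableAt,
    existsUnique_isEquilibriumState dumbbell_irreducible (dumbbellLeft_pos ha hb)
      (dumbbellLeft_eigen ha hb hexpx hexpy h2) (dumbbellRight_pos ha hb)
      (dumbbellRight_eigen' ha hb hexpx hexpy h2), fun m hm => ?_⟩
  have hvar := dumbbell_hasVariance ha hb hexpx hexpy h2 hm
  -- The variance is now known on the whole tangent plane as a form in `s`, `t` without mixed term;
  -- the pairs `(1,0)`, `(0,1)`, `(1,1)` give the coefficients.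
  simp_rw [← hcomb] at hvar
  have h10 : (1 : ℝ) • dumbbellDx x y + (0 : ℝ) • dumbbellDy x y = dumbbellDx x y := by simp
  have h01 : (0 : ℝ) • dumbbellDx x y + (1 : ℝ) • dumbbellDy x y = dumbbellDy x y := by simp
  have h11 : (1 : ℝ) • dumbbellDx x y + (1 : ℝ) • dumbbellDy x y =
      dumbbellDx x y + dumbbellDy x y := by simp
  have v10 := hvar 1 0
  have v01 := hvar 0 1
  have v11 := hvar 1 1
  rw [h10] at v10
  rw [h01] at v01
  rw [h11] at v11
  have hp3 : m.real {e | e.1 0 = (2, true)} =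
      a ^ 2 * b ^ 2 / (a ^ 2 + b ^ 2 + 4 * a ^ 2 * b ^ 2) := by
    rw [hm.measureReal_letter dumbbell_irreducible (dumbbellLeft_pos ha hb)
      (dumbbellLeft_eigen ha hb hexpx hexpy h2) (dumbbellRight_pos ha hb)
      (dumbbellRight_eigen' ha hb hexpx hexpy h2), dumbbell_sum_left_mul_right ha hb]
    simp [dumbbellLeft, dumbbellRight]
    field_simp
  have hden : 4 * Real.exp (x + y) - 3 * Real.exp x - 3 * Real.exp y + 2 =
      a ^ 2 + b ^ 2 + 4 * a ^ 2 * b ^ 2 := by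
    rw [Real.exp_add, hexpx, hexpy]
    ring
  -- `FP = 0` is supplied outright; the other three values are read off from the variances, and
  -- polarization then holds by algebra.
  refine ⟨edgeFun_mem_tangentSpace v10.1, edgeFun_mem_tangentSpace v01.1, _, 0, _, _,
    v10.2, ?_, ?_, v11.2, ?_, rfl, v01.2, ?_, ?_, fun s t => ?_⟩
  · rw [iteratedDeriv_two_dumbbellS_left hx hy, hp3, ← ha2, hexpx]
    field_simp
    ring
  · rw [hden, ← ha2, ← hb2, hexpx]
    ring
  · ring
  · rw [iteratedDeriv_two_dumbbellS_right hx hy, hp3, ← hb2, hexpy]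
    field_simp
    ring
  · rw [hden, ← ha2, ← hb2, hexpy]
    ring
  · convert (hvar s t).2 using 1
    ring
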